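/- Let $\{0,1\}^*$ be the set of finite binary strings. For an infinite binary sequence $X = X_0X_1X_2\dots$ and $n \in \mathbb{N}$, write $X \upharpoonright n$ for the string $X_0 \dots X_{n-1}$. Fix, once and for all, a canonical universal prefix-free oracle machine $U$ (a different choice changes the complexities below only by an additive constant): for every sequence $X$, the partial function $U^X$ on $\{0,1\}^*$ is partial recursive in $X$ and has a prefix-free domain, and for every partial function $M$ that is partial recursive in $X$ and has a prefix-free domain there is a string $h$ with $U^X(hp) = M(p)$ for all strings $p$ (both sides being undefined together). The self-delimiting Kolmogorov complexity of a string $\sigma$ relative to $X$ is $$K^X(\sigma) = \min\{|\pi| : U^X(\pi) = \sigma\},$$ and $K(\sigma) = K^{0^\infty}(\sigma)$, i.e. no information is available from the oracle. An infinite binary sequence $A$ is *incompressible* if there is a constant $c$ such that $K(A \upharpoonright n) \ge n - c$ for all $n$. It is *$B$-incompressible* if there is a constant $c$ such that $K^B(A \upharpoonright n) \ge n - c$ for all $n$. The interleaving of $A$ and $B$ is $A \uplus B = A_0 B_0 A_1 B_1 \dots$. **Lemma.** Let $A$ and $B$ be infinite binary sequences. If $B$ is incompressible and $A$ is $B$-incompressible,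 then $A \uplus B$ is incompressible. -/

import Mathlib

namespace AlgInfo

/-- A finite binary string; its length is `List.length`, the empty string is `[]`. -/
abbrev Str := List Bool

/-- An infinite binary sequence. -/
abbrev BinSeq := ℕ → Bool

/-- `restrict X n` is the string `X₀ X₁ … Xₙ₋₁` of the first `n` bits of `X`. -/
def restrict (X : BinSeq) (n : ℕ) : Str := (List.range n).map X

/-- The sequence `A₀ B₀ A₁ B₁ …`. -/
def interleave (A B : BinSeq) : BinSeq :=
  fun n => if n % 2 = 0 then A (n / 2) else B (n / 2)

/-! ### The oracle, prefix-free machines, and universal machines -/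

/-- The characteristic function of the sequence `X`, as an oracle for `RecursiveIn`. -/
def oracleOf (X : BinSeq) : ℕ →. ℕ := fun n => Part.some (X n).toNat

/-- No element of `S` is a proper prefix of another element of `S`. -/
def PrefixFree (S : Set Str) : Prop :=
  ∀ p ∈ S, ∀ q ∈ S, p <+: q → p = q

/-- `M` is a prefix-free (self-delimiting) machine with oracle `X`: a partial function on strings
that is partial recursive in `X` and whose domain is prefix-free. -/
def IsPrefixFreeMachine (X : BinSeq) (M : Str →. Str) : Prop :=
  RecursiveIn {oracleOf X} M ∧ PrefixFree M.Dom

/-- `U` is a universal prefix-free machine with oracle `X`: it is itself a prefix-free machine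
with oracle `X`, and it simulates every such machine after a fixed header. -/
def IsUniversalPrefixFree (X : BinSeq) (U : Str →. Str) : Prop :=
  IsPrefixFreeMachine X U ∧
    ∀ M : Str →. Str, IsPrefixFreeMachine X M → ∃ h : Str, ∀ p : Str, U (h ++ p) = M p

/-! ### A concrete universal prefix-free oracle machine

A program `c` (a code for an ordinary partial recursive function) is run with oracle `X` on the
input string `q` by giving it the pair `(X ↾ n, q)`, for all `n`, in a dovetailed way. -/

/-- The `m`-th event in the run of the program `c` with oracle `X`. If `m` codes `(q, n, t)`, and
`c` halts within `t` steps on the pair `(X ↾ n, q)` with output the string `s`, then the event is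
`(q, s)`: "input `q` has produced output `s`". Otherwise nothing happens. -/
def event (X : BinSeq) (c : Nat.Partrec.Code) (m : ℕ) : Option (Str × Str) :=
  (Encodable.decode (α := Str × ℕ × ℕ) m).bind fun r =>
    ((Nat.Partrec.Code.evaln r.2.2 c (Encodable.encode (restrict X r.2.1, r.1))).bind
      fun v => Encodable.decode (α := Str) v).map fun s => (r.1, s)

/-- The prefix-free version of the program `c` with oracle `X`. On input `p`, wait for the first
event whose input is comparable with `p` (one is a prefix of the other). If that input is `p`
itself, output the string that has been produced; otherwise diverge. -/
def prefixFreeRun (X : BinSeq) (c : Nat.Partrec.Code) (p : Str) : Part Str :=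
  (Nat.rfindOpt fun m =>
      (event X c m).bind fun r => if r.1 <+: p ∨ p <+: r.1 then some r else none).bind
    fun r => ((if r.1 = p then some r.2 else none : Option Str) : Part Str)

/-- The universal prefix-free oracle machine. On input `0ᵉ 1 p` it runs the prefix-free version of
the program with number `e` on the input `p`. Inputs without a `1` are outside the domain. -/
def universal (X : BinSeq) : Str →. Str := fun w =>
  if w.findIdx id < w.length then
    prefixFreeRun X (Denumerable.ofNat Nat.Partrec.Code (w.findIdx id)) (w.drop (w.findIdx id + 1))
  else Part.none

/-- The self-delimiting Kolmogorov complexity `K^X(s)` of the string `s` relative to `X`: the least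
length of an input on which the universal machine with oracle `X` outputs `s`. -/
noncomputable def relK (X : BinSeq) (s : Str) : ℕ :=
  sInf {k | ∃ w : Str, w.length = k ∧ s ∈ universal X w}

/-- The self-delimiting Kolmogorov complexity `K(s)`: no information is available from the oracle,
which is the zero sequence. -/
noncomputable def prefixK (s : Str) : ℕ := relK (fun _ => false) s

/-- `∃ c, ∀ n, K(A ↾ n) ≥ n - c`. -/
def Incompressible (A : BinSeq) : Prop :=
  ∃ c : ℕ, ∀ n : ℕ, (n : ℤ) - c ≤ prefixK (restrict A n)

/-- `A` is `B`-incompressible: `∃ c, ∀ n, K^B(A ↾ n) ≥ n - c`. -/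
def IncompressibleRel (B A : BinSeq) : Prop :=
  ∃ c : ℕ, ∀ n : ℕ, (n : ℤ) - c ≤ relK B (restrict A n)

/-! ### The machine is a universal prefix-free machine -/

theorem restrict_length (X : BinSeq) (n : ℕ) : (restrict X n).length = n := by
  simp [restrict]

theorem restrict_take (X : BinSeq) {n m : ℕ} (h : n ≤ m) :
    (restrict X m).take n = restrict X n := by
  simp [restrict, ← List.map_take, List.take_range, Nat.min_eq_left h]

theorem recursiveIn_of_computable {O : Set (ℕ →. ℕ)} {f : ℕ → ℕ} (hf : Computable f) :
    Nat.RecursiveIn O fun n => Part.some (f n) :=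
  Nat.Partrec.recursiveIn (Partrec.nat_iff.1 hf.partrec)

theorem restrict_recursiveIn (X : BinSeq) :
    Nat.RecursiveIn {oracleOf X} fun n => Part.some (Encodable.encode (restrict X n)) := by
  have hX : Nat.RecursiveIn {oracleOf X} fun n => Part.some (X n).toNat := .oracle _ rfl
  have hstep : Computable fun z : ℕ =>
      Encodable.encode (((Encodable.decode (α := Str) z.unpair.2).getD []) ++
        [decide (z.unpair.1 = 1)]) := by
    apply Primrec.to_comp
    refine Primrec.encode.comp (Primrec.list_concat.comp ?_ ?_)
    · exact Primrec.option_getD.comp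
        (Primrec.decode.comp (Primrec.snd.comp Primrec.unpair)) (Primrec.const [])
    · exact PrimrecPred.decide
        (PrimrecRel.comp Primrec.eq (Primrec.fst.comp Primrec.unpair) (Primrec.const 1))
  have hright : Nat.RecursiveIn {oracleOf X} fun n => Part.some n.unpair.2 := .right
  have hleft : Nat.RecursiveIn {oracleOf X} fun n => Part.some n.unpair.1 := .left
  have hbody := Nat.RecursiveIn.comp (recursiveIn_of_computable hstep)
    (.pair (.comp hX (.comp hleft hright)) (.comp hright hright))
  have hp := Nat.RecursiveIn.prec
    (recursiveIn_of_computable (Computable.const (Encodable.encode ([] : Str)))) hbody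
  have hin : Nat.RecursiveIn {oracleOf X} fun n => Part.some (Nat.pair 0 n) :=
    recursiveIn_of_computable
      (Primrec.to_comp (Primrec₂.natPair.comp (Primrec.const 0) Primrec.id))
  refine (Nat.RecursiveIn.comp hp hin).of_eq fun n => ?_
  simp only [Part.bind_eq_bind, Part.bind_some, Nat.unpair_pair]
  induction n with
  | zero => simp [restrict]
  | succ n ih =>
    simp only [ih]
    simp [restrict, List.range_succ, Seq.seq]

theorem search_recursiveIn (X : BinSeq) (F : ℕ → Str → ℕ → Option ℕ)
    (hF : Computable fun z : ℕ × Str × ℕ => F z.1 z.2.1 z.2.2) :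
    Nat.RecursiveIn {oracleOf X} fun a => Nat.rfindOpt fun m => F a (restrict X m) m := by
  have hright : Nat.RecursiveIn {oracleOf X} fun n => Part.some n.unpair.2 := .right
  have hid : Nat.RecursiveIn {oracleOf X} fun n => Part.some n :=
    recursiveIn_of_computable Computable.id
  have hT := Nat.RecursiveIn.pair hid (.comp (restrict_recursiveIn X) hright)
  have hG : Computable fun w : ℕ =>
      F w.unpair.1.unpair.1 ((Encodable.decode (α := Str) w.unpair.2).getD [])
        w.unpair.1.unpair.2 := by
    refine hF.comp (.pair ?_ (.pair ?_ ?_)) <;> apply Primrec.to_comp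
    · exact Primrec.fst.comp (Primrec.unpair.comp (Primrec.fst.comp Primrec.unpair))
    · exact Primrec.option_getD.comp
        (Primrec.decode.comp (Primrec.snd.comp Primrec.unpair)) (Primrec.const [])
    · exact Primrec.snd.comp (Primrec.unpair.comp (Primrec.fst.comp Primrec.unpair))
  have hH : Nat.RecursiveIn {oracleOf X} _ :=
    Nat.Partrec.recursiveIn (Partrec.nat_iff.1 hG.ofOption)
  have hI : Nat.RecursiveIn {oracleOf X} fun w => Part.some _ :=
    recursiveIn_of_computable
      (Computable.option_casesOn hG (Computable.const 1) (Computable.const 0).to₂)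
  have hV : Nat.RecursiveIn {oracleOf X} fun z =>
      (F z.unpair.1 (restrict X z.unpair.2) z.unpair.2 : Part ℕ) :=
    (Nat.RecursiveIn.comp hH hT).of_eq fun z => by simp [Seq.seq]
  have hP : Nat.RecursiveIn {oracleOf X} fun z => Part.some
      (Option.casesOn (motive := fun _ => ℕ)
        (F z.unpair.1 (restrict X z.unpair.2) z.unpair.2) 1 fun _ => 0) :=
    (Nat.RecursiveIn.comp hI hT).of_eq fun z => by simp [Seq.seq]
  refine (Nat.RecursiveIn.comp hV (.pair hid (.rfind hP))).of_eq fun a => ?_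
  have key : (fun n => (fun m => decide (m = 0)) <$> Part.some
      (Option.casesOn (motive := fun _ => ℕ)
        (F (Nat.pair a n).unpair.1 (restrict X (Nat.pair a n).unpair.2) (Nat.pair a n).unpair.2)
          1 fun _ => 0))
      = fun n => Part.some (F a (restrict X n) n).isSome := by
    funext n
    simp only [Nat.unpair_pair]
    cases F a (restrict X n) n <;> simp
  rw [key]
  simp [Seq.seq, Nat.rfindOpt, Part.bind_map]

/-- `event`, with the oracle replaced by a string. -/
def eventOn (x : Str) (c : Nat.Partrec.Code) (m : ℕ) : Option (Str × Str) :=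
  (Encodable.decode (α := Str × ℕ × ℕ) m).bind fun r =>
    ((Nat.Partrec.Code.evaln r.2.2 c (Encodable.encode (x.take r.2.1, r.1))).bind
      fun v => Encodable.decode (α := Str) v).map fun s => (r.1, s)

theorem event_eq (X : BinSeq) (c : Nat.Partrec.Code) (m : ℕ) :
    event X c m = eventOn (restrict X m) c m := by
  unfold event eventOn
  cases h : Encodable.decode (α := Str × ℕ × ℕ) m with
  | none => rfl
  | some r =>
    have h1 : r.2.1 ≤ m := by
      have h2 : r.2.1 = m.unpair.2.unpair.1 := by
        simp only [Encodable.decode_prod_val, Encodable.decode_nat, Option.map_some,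
          Option.bind_some, Option.bind_eq_some_iff, Option.some.injEq] at h
        obtain ⟨_, _, rfl⟩ := h
        rfl
      rw [h2]
      exact (Nat.unpair_left_le _).trans (Nat.unpair_right_le _)
    simp only [Option.bind_some, restrict_take X h1]

theorem eventOn_primrec :
    Primrec fun z : (Str × Nat.Partrec.Code) × ℕ => eventOn z.1.1 z.1.2 z.2 := by
  unfold eventOn
  refine Primrec.option_bind (Primrec.decode.comp Primrec.snd) ?_
  refine Primrec.option_map (Primrec.option_bind ?_ (Primrec.decode.comp Primrec.snd).to₂) ?_
  · refine Nat.Partrec.Code.primrec_evaln.comp (.pair (.pair ?_ ?_) (Primrec.encode.comp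
      (.pair (Primrec.list_take.comp ?_ ?_) ?_)))
    · exact Primrec.snd.comp (Primrec.snd.comp Primrec.snd)
    · exact Primrec.snd.comp (Primrec.fst.comp Primrec.fst)
    · exact Primrec.fst.comp (Primrec.snd.comp Primrec.snd)
    · exact Primrec.fst.comp (Primrec.fst.comp Primrec.fst)
    · exact Primrec.fst.comp Primrec.snd
  · exact (Primrec.pair (Primrec.fst.comp (Primrec.snd.comp Primrec.fst)) Primrec.snd).to₂

/-- The first stage of `universal`, with the oracle replaced by a string: the event number `m`,
if it is of interest for the input `w`, together with the input of the simulated program. -/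
def firstStage (w : Str) (x : Str) (m : ℕ) : Option (Str × Str × Str) :=
  if w.findIdx id < w.length then
    (eventOn x (Denumerable.ofNat Nat.Partrec.Code (w.findIdx id)) m).bind fun r =>
      if r.1 <+: w.drop (w.findIdx id + 1) ∨ w.drop (w.findIdx id + 1) <+: r.1 then
        some (w.drop (w.findIdx id + 1), r) else none
  else none

theorem isPrefix_primrec : PrimrecRel fun p q : Str => p <+: q := by
  have : PrimrecRel fun p q : Str => p = q.take p.length :=
    PrimrecRel.comp Primrec.eq Primrec.fst
      (Primrec.list_take.comp (Primrec.list_length.comp Primrec.fst) Primrec.snd)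
  exact this.of_eq fun p q => List.prefix_iff_eq_take.symm

theorem firstStage_primrec :
    Primrec fun z : Str × Str × ℕ => firstStage z.1 z.2.1 z.2.2 := by
  have hidx : Primrec fun w : Str => w.findIdx id :=
    Primrec.list_findIdx Primrec.id Primrec.snd.to₂
  have hdrop : Primrec fun w : Str => w.drop (w.findIdx id + 1) :=
    Primrec.list_drop.comp (Primrec.succ.comp hidx) Primrec.id
  unfold firstStage
  refine Primrec.ite (PrimrecRel.comp Primrec.nat_lt (hidx.comp Primrec.fst)
    (Primrec.list_length.comp Primrec.fst)) ?_ (Primrec.const none)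
  refine Primrec.option_bind (eventOn_primrec.comp (.pair (.pair (Primrec.fst.comp Primrec.snd)
    ((Primrec.ofNat _).comp (hidx.comp Primrec.fst))) (Primrec.snd.comp Primrec.snd))) ?_
  have hd : Primrec fun z : (Str × Str × ℕ) × Str × Str => z.1.1.drop (z.1.1.findIdx id + 1) :=
    hdrop.comp (Primrec.fst.comp Primrec.fst)
  have hr : Primrec fun z : (Str × Str × ℕ) × Str × Str => z.2.1 :=
    Primrec.fst.comp Primrec.snd
  exact Primrec.ite (PrimrecPred.or (isPrefix_primrec.comp hr hd) (isPrefix_primrec.comp hd hr))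
    (Primrec.option_some.comp (.pair hd Primrec.snd)) (Primrec.const none)

theorem mem_rfindOpt_iff {α : Type*} {f : ℕ → Option α} {a : α} :
    a ∈ Nat.rfindOpt f ↔ ∃ m, f m = some a ∧ ∀ k < m, f k = none := by
  unfold Nat.rfindOpt
  rw [Part.mem_bind_iff]
  constructor
  · rintro ⟨m, hm, ha⟩
    refine ⟨m, by simpa using ha, fun k hk => ?_⟩
    simpa using (Nat.mem_rfind.1 hm).2 hk
  · rintro ⟨m, hm, h⟩
    refine ⟨m, Nat.mem_rfind.2 ⟨by simp [hm], fun {k} hk => by simp [h k hk]⟩, by simp [hm]⟩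

/-- The run ends at the first event whose input is comparable with `p`. -/
theorem mem_prefixFreeRun {X : BinSeq} {c : Nat.Partrec.Code} {p s : Str} :
    s ∈ prefixFreeRun X c p ↔ ∃ m, event X c m = some (p, s) ∧
      ∀ k < m, ∀ r, event X c k = some r → ¬ (r.1 <+: p ∨ p <+: r.1) := by
  have hnone : ∀ k, ((event X c k).bind fun r =>
      if r.1 <+: p ∨ p <+: r.1 then some r else none) = none ↔
      ∀ r, event X c k = some r → ¬ (r.1 <+: p ∨ p <+: r.1) := by
    intro k
    cases event X c k with
    | none => simp
    | some r => simp
  unfold prefixFreeRun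
  rw [Part.mem_bind_iff]
  constructor
  · rintro ⟨r, hr, hs⟩
    obtain ⟨m, hm, h⟩ := mem_rfindOpt_iff.1 hr
    refine ⟨m, ?_, fun k hk => (hnone k).1 (h k hk)⟩
    obtain ⟨r', hr', h2⟩ := Option.bind_eq_some_iff.1 hm
    split_ifs at h2 with h3
    obtain rfl : r' = r := by simpa using h2
    split_ifs at hs with h4
    · obtain rfl : s = r'.2 := by simpa using hs
      subst h4
      exact hr'
    · simp at hs
  · rintro ⟨m, hm, h⟩
    refine ⟨(p, s), mem_rfindOpt_iff.2 ⟨m, by simp [hm], fun k hk => (hnone k).2 (h k hk)⟩, ?_⟩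
    simp

theorem universal_eq (X : BinSeq) (w : Str) :
    universal X w = (Nat.rfindOpt fun m => firstStage w (restrict X m) m).bind fun r =>
      ((if r.2.1 = r.1 then some r.2.2 else none : Option Str) : Part Str) := by
  unfold universal firstStage
  split_ifs with hw
  · ext s
    rw [mem_prefixFreeRun, Part.mem_bind_iff]
    generalize Denumerable.ofNat Nat.Partrec.Code (w.findIdx id) = c
    generalize w.drop (w.findIdx id + 1) = p
    simp only [← event_eq]
    have hnone : ∀ k, ((event X c k).bind fun r =>
        if r.1 <+: p ∨ p <+: r.1 then some (p, r) else none) = none ↔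
        ∀ r, event X c k = some r → ¬ (r.1 <+: p ∨ p <+: r.1) := by
      intro k
      cases event X c k with
      | none => simp
      | some r => simp
    constructor
    · rintro ⟨m, hm, h⟩
      refine ⟨(p, p, s), mem_rfindOpt_iff.2
        ⟨m, by simp [hm], fun k hk => (hnone k).2 (h k hk)⟩, ?_⟩
      simp
    · rintro ⟨r, hr, hs⟩
      obtain ⟨m, hm, h⟩ := mem_rfindOpt_iff.1 hr
      refine ⟨m, ?_, fun k hk => (hnone k).1 (h k hk)⟩
      obtain ⟨r', hr', h2⟩ := Option.bind_eq_some_iff.1 hm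
      split_ifs at h2 with h3
      obtain rfl : (p, r') = r := by simpa using h2
      split_ifs at hs with h4
      · obtain rfl : s = r'.2 := by simpa using hs
        simp only at h4
        subst h4
        exact hr'
      · simp at hs
  · ext s
    rw [Part.mem_bind_iff]
    simp only [Part.notMem_none, false_iff]
    rintro ⟨r, hr, -⟩
    obtain ⟨m, hm, -⟩ := mem_rfindOpt_iff.1 hr
    simp at hm

theorem lastStage_primrec : Primrec fun z : ℕ =>
      (Encodable.decode (α := Str × Str × Str) z).bind fun r =>
        if r.2.1 = r.1 then some (Encodable.encode r.2.2) else none := by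
  refine Primrec.option_bind Primrec.decode ?_
  have h1 : Primrec fun z : ℕ × Str × Str × Str => z.2.2.1 :=
    Primrec.fst.comp (Primrec.snd.comp Primrec.snd)
  have h2 : Primrec fun z : ℕ × Str × Str × Str => z.2.1 :=
    Primrec.fst.comp Primrec.snd
  have h3 : Primrec fun z : ℕ × Str × Str × Str => z.2.2.2 :=
    Primrec.snd.comp (Primrec.snd.comp Primrec.snd)
  exact Primrec.ite (PrimrecRel.comp Primrec.eq h1 h2)
    (Primrec.option_some.comp (Primrec.encode.comp h3)) (Primrec.const none)

theorem coded_primrec {g : Str → Str → ℕ → Option (Str × Str × Str)}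
    (hg : Primrec fun z : Str × Str × ℕ => g z.1 z.2.1 z.2.2) :
    Primrec fun z : ℕ × Str × ℕ =>
      (Encodable.decode (α := Str) z.1).bind fun w =>
        (g w z.2.1 z.2.2).map Encodable.encode := by
  refine Primrec.option_bind (Primrec.decode.comp Primrec.fst) ?_
  refine Primrec.option_map (hg.comp
    (.pair Primrec.snd (Primrec.snd.comp Primrec.fst))) ?_
  exact (Primrec.encode.comp Primrec.snd).to₂

theorem universal_recursiveIn (X : BinSeq) : RecursiveIn {oracleOf X} (universal X) := by
  have h1 := search_recursiveIn X
    (fun a x m => (Encodable.decode (α := Str) a).bind fun w =>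
      (firstStage w x m).map Encodable.encode) (coded_primrec firstStage_primrec).to_comp
  have h2 : Nat.RecursiveIn {oracleOf X} _ :=
    Nat.Partrec.recursiveIn (Partrec.nat_iff.1 lastStage_primrec.to_comp.ofOption)
  refine (Nat.RecursiveIn.comp h2 h1).of_eq fun n => ?_
  cases hn : Encodable.decode (α := Str) n with
  | none =>
    ext v
    simp [Part.mem_bind_iff, mem_rfindOpt_iff]
  | some w =>
    ext v
    simp only [Option.bind_some, Part.bind_eq_bind, Part.coe_some, Part.bind_some, universal_eq,
      Part.mem_bind_iff, Part.mem_map_iff, mem_rfindOpt_iff]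
    constructor
    · rintro ⟨z, ⟨m, hm, h⟩, hv⟩
      obtain ⟨r, hr, rfl⟩ := Option.map_eq_some_iff.1 hm
      simp only [Encodable.encodek, Option.bind_some] at hv
      split_ifs at hv with h4
      · refine ⟨r.2.2, ⟨r, ⟨m, hr, fun k hk => by simpa using h k hk⟩, by simp [h4]⟩, ?_⟩
        exact (by simpa using hv : v = Encodable.encode r.2.2).symm
      · simp at hv
    · rintro ⟨s, ⟨r, ⟨m, hr, h⟩, hs⟩, rfl⟩
      refine ⟨Encodable.encode r, ⟨m, by simp [hr], fun k hk => by simp [h k hk]⟩, ?_⟩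
      split_ifs at hs with h4
      · obtain rfl : s = r.2.2 := by simpa using hs
        simp [h4]
      · simp at hs

theorem prefixFreeRun_prefixFree {X : BinSeq} {c : Nat.Partrec.Code} {p q s t : Str}
    (hp : s ∈ prefixFreeRun X c p) (hq : t ∈ prefixFreeRun X c q) (h : p <+: q) : p = q := by
  obtain ⟨m, hm, hm'⟩ := mem_prefixFreeRun.1 hp
  obtain ⟨k, hk, hk'⟩ := mem_prefixFreeRun.1 hq
  rcases lt_trichotomy m k with hlt | rfl | hlt
  · exact absurd (Or.inl h) (hk' m hlt _ hm)
  · simpa using congrArg (Option.map Prod.fst) (hm.symm.trans hk)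
  · exact absurd (Or.inr h) (hm' k hlt _ hk)

theorem header_findIdx (e : ℕ) (p : Str) :
    (List.replicate e false ++ true :: p).findIdx id = e := by
  induction e with
  | zero => simp [List.findIdx_cons]
  | succ e ih => simp [List.replicate_succ, List.findIdx_cons, ih]

theorem universal_header (X : BinSeq) (e : ℕ) (p : Str) :
    universal X (List.replicate e false ++ true :: p) =
      prefixFreeRun X (Denumerable.ofNat Nat.Partrec.Code e) p := by
  unfold universal
  rw [header_findIdx, if_pos (by simp)]
  congr 1
  rw [← List.drop_drop]
  simp

theorem eq_header {w : Str} (h : w.findIdx id < w.length) :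
    ∃ e p, w = List.replicate e false ++ true :: p := by
  induction w with
  | nil => simp at h
  | cons b w ih =>
    cases b with
    | true => exact ⟨0, w, rfl⟩
    | false =>
      obtain ⟨e, p, rfl⟩ := ih (by simpa [List.findIdx_cons] using h)
      exact ⟨e + 1, p, rfl⟩

theorem header_of_mem {X : BinSeq} {w s : Str} (h : s ∈ universal X w) :
    ∃ e p, w = List.replicate e false ++ true :: p := by
  by_cases hw : w.findIdx id < w.length
  · exact eq_header hw
  · rw [universal, if_neg hw] at h
    simp at h

theorem header_prefix {e d : ℕ} {p q : Str}
    (h : List.replicate e false ++ true :: p <+: List.replicate d false ++ true :: q) :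
    e = d ∧ p <+: q := by
  induction e generalizing d with
  | zero =>
    cases d with
    | zero => simpa using h
    | succ d => simp [List.replicate_succ] at h
  | succ e ih =>
    cases d with
    | zero => simp [List.replicate_succ] at h
    | succ d =>
      obtain ⟨h1, h2⟩ := ih (d := d) (by simpa [List.replicate_succ] using h)
      exact ⟨by rw [h1], h2⟩

theorem universal_prefixFree (X : BinSeq) : PrefixFree (universal X).Dom := by
  intro w hw v hv h
  obtain ⟨s, hs⟩ := Part.dom_iff_mem.1 hw
  obtain ⟨t, ht⟩ := Part.dom_iff_mem.1 hv
  obtain ⟨e, p, rfl⟩ := header_of_mem hs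
  obtain ⟨d, q, rfl⟩ := header_of_mem ht
  obtain ⟨rfl, h'⟩ := header_prefix h
  rw [universal_header] at hs ht
  rw [prefixFreeRun_prefixFree hs ht h']

theorem mem_pair_iff {a b : Part ℕ} {v : ℕ} :
    v ∈ (Nat.pair <$> a <*> b) ↔ ∃ x ∈ a, ∃ y ∈ b, Nat.pair x y = v := by
  simp [Seq.seq]

theorem normal_form (X : BinSeq) {f : ℕ →. ℕ} (hf : Nat.RecursiveIn {oracleOf X} f) :
    ∃ F : Str × ℕ →. ℕ, Partrec F ∧
      (∀ k n v, v ∈ F (restrict X k, n) → v ∈ f n) ∧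
      (∀ n v, v ∈ f n → ∀ᶠ k in Filter.atTop, v ∈ F (restrict X k, n)) := by
  induction hf with
  | zero => exact ⟨fun _ => Part.some 0, (Computable.const 0).partrec, fun _ _ _ h => h,
      fun _ _ h => Filter.Eventually.of_forall fun _ => h⟩
  | succ => exact ⟨fun p => Part.some (p.2 + 1), (Computable.succ.comp Computable.snd).partrec,
      by simp, by simp⟩
  | left => exact ⟨fun p => Part.some p.2.unpair.1,
      (Computable.fst.comp (Computable.unpair.comp Computable.snd)).partrec, by simp, by simp⟩
  | right => exact ⟨fun p => Part.some p.2.unpair.2,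
      (Computable.snd.comp (Computable.unpair.comp Computable.snd)).partrec, by simp, by simp⟩
  | oracle g hg =>
    obtain rfl : g = oracleOf X := hg
    refine ⟨fun p => ((p.1[p.2]?).map Bool.toNat : Option ℕ),
      (Computable.option_map (Computable.list_getElem?.comp Computable.fst Computable.snd)
        ((Primrec.dom_finite Bool.toNat).to_comp.comp Computable.snd).to₂).ofOption, ?_, ?_⟩
    · intro k n v hv
      simp [restrict] at hv
      simp [oracleOf]
      grind
    · intro n v hv
      filter_upwards [Filter.eventually_gt_atTop n] with k hk
      simp [oracleOf] at hv
      simp [restrict, hk, hv]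
  | pair _ _ ihf ihh =>
    obtain ⟨F, hF, hF1, hF2⟩ := ihf
    obtain ⟨H, hH, hH1, hH2⟩ := ihh
    refine ⟨fun p => (F p).bind fun a => (H p).map fun b => Nat.pair a b, ?_, ?_, ?_⟩
    · exact hF.bind ((hH.comp Computable.fst).map
        (Primrec₂.natPair.to_comp.comp (Computable.snd.comp Computable.fst) Computable.snd))
    · intro k n v hv
      obtain ⟨a, ha, hv⟩ := Part.mem_bind_iff.1 hv
      obtain ⟨b, hb, hv⟩ := (Part.mem_map_iff _).1 hv
      exact mem_pair_iff.2 ⟨a, hF1 _ _ _ ha, b, hH1 _ _ _ hb, hv⟩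
    · intro n v hv
      obtain ⟨a, ha, b, hb, hv⟩ := mem_pair_iff.1 hv
      filter_upwards [hF2 _ _ ha, hH2 _ _ hb] with k h1 h2
      exact Part.mem_bind_iff.2 ⟨a, h1, (Part.mem_map_iff _).2 ⟨b, h2, hv⟩⟩
  | comp _ _ ihf ihh =>
    obtain ⟨F, hF, hF1, hF2⟩ := ihf
    obtain ⟨H, hH, hH1, hH2⟩ := ihh
    refine ⟨fun p => (H p).bind fun a => F (p.1, a), ?_, ?_, ?_⟩
    · exact hH.bind (hF.comp (.pair (Computable.fst.comp Computable.fst) Computable.snd))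
    · intro k n v hv
      obtain ⟨a, ha, hv⟩ := Part.mem_bind_iff.1 hv
      exact Part.mem_bind_iff.2 ⟨a, hH1 _ _ _ ha, hF1 _ _ _ hv⟩
    · intro n v hv
      obtain ⟨a, ha, hv⟩ := Part.mem_bind_iff.1 hv
      filter_upwards [hF2 _ _ hv, hH2 _ _ ha] with k h1 h2
      exact Part.mem_bind_iff.2 ⟨a, h2, h1⟩
  | @prec f h _ _ ihf ihh =>
    obtain ⟨F, hF, hF1, hF2⟩ := ihf
    obtain ⟨H, hH, hH1, hH2⟩ := ihh
    refine ⟨fun p => p.2.unpair.2.rec (F (p.1, p.2.unpair.1)) fun y IH =>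
      IH.bind fun i => H (p.1, Nat.pair p.2.unpair.1 (Nat.pair y i)), ?_, ?_, ?_⟩
    · refine Partrec.nat_rec
        (h := fun p q => H (p.1, Nat.pair p.2.unpair.1 (Nat.pair q.1 q.2)))
        (Computable.snd.comp (Computable.unpair.comp Computable.snd))
        (hF.comp (.pair Computable.fst
          (Computable.fst.comp (Computable.unpair.comp Computable.snd)))) ?_
      refine (hH.comp (.pair (Computable.fst.comp Computable.fst)
        (Primrec₂.natPair.to_comp.comp (Computable.fst.comp (Computable.unpair.comp
          (Computable.snd.comp Computable.fst))) (Primrec₂.natPair.to_comp.comp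
            (Computable.fst.comp Computable.snd) (Computable.snd.comp Computable.snd))))).to₂
    · intro k p v hv
      dsimp only at hv ⊢
      generalize p.unpair.1 = a at *
      generalize p.unpair.2 = n at *
      induction n generalizing v with
      | zero => exact hF1 _ _ _ hv
      | succ n ih =>
        simp at hv ⊢
        obtain ⟨i, hi, hv⟩ := hv
        exact ⟨i, ih _ hi, hH1 _ _ _ hv⟩
    · intro p v hv
      dsimp only at hv ⊢
      generalize p.unpair.1 = a at *
      generalize p.unpair.2 = n at *
      induction n generalizing v with
      | zero => exact hF2 _ _ hv
      | succ n ih =>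
        simp at hv
        obtain ⟨i, hi, hv⟩ := hv
        filter_upwards [ih _ hi, hH2 _ _ hv] with k h1 h2
        simp
        exact ⟨i, h1, h2⟩
  | @rfind f _ ihf =>
    obtain ⟨F, hF, hF1, hF2⟩ := ihf
    refine ⟨fun p => Nat.rfind fun n => (F (p.1, Nat.pair p.2 n)).map fun m => decide (m = 0),
      ?_, ?_, ?_⟩
    · refine Partrec.rfind ((hF.comp (.pair (Computable.fst.comp Computable.fst)
        (Primrec₂.natPair.to_comp.comp (Computable.snd.comp Computable.fst)
          Computable.snd))).map ?_)
      exact ((PrimrecPred.decide (PrimrecRel.comp Primrec.eq Primrec.snd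
        (Primrec.const 0))).to_comp).to₂
    · intro k n v hv
      refine Nat.mem_rfind.2 ?_
      replace hv := Nat.mem_rfind.1 hv
      simp at hv ⊢
      exact ⟨hF1 _ _ _ hv.1, fun hm => by
        obtain ⟨x, hx, h0⟩ := hv.2 hm
        exact ⟨x, hF1 _ _ _ hx, h0⟩⟩
    · intro n v hv
      replace hv := Nat.mem_rfind.1 hv
      simp at hv
      obtain ⟨h0, hlt⟩ := hv
      have h1 : ∀ m ∈ Finset.range v, ∀ᶠ k in Filter.atTop,
          ∃ x ∈ F (restrict X k, Nat.pair n m), x ≠ 0 := by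
        intro m hm
        obtain ⟨x, hx, hx0⟩ := hlt (Finset.mem_range.1 hm)
        filter_upwards [hF2 _ _ hx] with k hk
        exact ⟨x, hk, hx0⟩
      filter_upwards [hF2 _ _ h0, (Filter.eventually_all_finset _).2 h1] with k h2 h3
      refine Nat.mem_rfind.2 ?_
      simp
      exact ⟨h2, fun {m} hm => by
        obtain ⟨x, hx, h⟩ := h3 m (Finset.mem_range.2 hm)
        exact ⟨x, hx, h⟩⟩

theorem exists_prefixFreeRun (X : BinSeq) {M : Str →. Str} (hM : IsPrefixFreeMachine X M) :
    ∃ c : Nat.Partrec.Code, ∀ p, prefixFreeRun X c p = M p := by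
  obtain ⟨hM, hfree⟩ := hM
  obtain ⟨F, hF, hF1, hF2⟩ := normal_form X hM
  have hF' : Partrec fun z : Str × Str => F (z.1, Encodable.encode z.2) :=
    hF.comp (.pair Computable.fst (Computable.encode.comp Computable.snd))
  obtain ⟨c, hc⟩ := Nat.Partrec.Code.exists_code.1 hF'
  have hc' : ∀ x p : Str, Nat.Partrec.Code.eval c (Encodable.encode (x, p)) =
      F (x, Encodable.encode p) := by
    intro x p
    rw [hc]
    simp only [Encodable.encodek, Part.coe_some, Part.bind_some]
    exact Part.map_id' (fun _ => rfl) _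
  have hM' : ∀ p v, v ∈ ((Encodable.decode (α := Str) (Encodable.encode p) : Part Str).bind
      fun a => (M a).map Encodable.encode) ↔ ∃ s ∈ M p, Encodable.encode s = v := by
    intro p v
    simp only [Encodable.encodek, Part.coe_some, Part.bind_some, Part.mem_map_iff]
  have hsound : ∀ m q s, event X c m = some (q, s) → s ∈ M q := by
    intro m q s h
    obtain ⟨⟨q', n, t⟩, -, h⟩ := Option.bind_eq_some_iff.1 h
    obtain ⟨s', h, h'⟩ := Option.map_eq_some_iff.1 h
    obtain ⟨v, hv, hs⟩ := Option.bind_eq_some_iff.1 h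
    simp only [Prod.mk.injEq] at h'
    obtain ⟨rfl, rfl⟩ := h'
    have h1 := Nat.Partrec.Code.evaln_sound hv
    rw [hc'] at h1
    obtain ⟨s, h2, rfl⟩ := (hM' _ _).1 (hF1 _ _ _ h1)
    rw [Encodable.encodek] at hs
    obtain rfl : s = s' := by simpa using hs
    exact h2
  have hcomplete : ∀ p s, s ∈ M p → ∃ m, event X c m = some (p, s) := by
    intro p s h
    obtain ⟨n, hn⟩ := (hF2 _ _ ((hM' p _).2 ⟨s, h, rfl⟩)).exists
    rw [← hc'] at hn
    obtain ⟨t, ht⟩ := Nat.Partrec.Code.evaln_complete.1 hn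
    refine ⟨Encodable.encode (p, n, t), ?_⟩
    unfold event
    rw [Encodable.encodek, Option.bind_some, Option.mem_def.1 ht]
    simp
  refine ⟨c, fun p => ?_⟩
  ext s
  rw [mem_prefixFreeRun]
  constructor
  · rintro ⟨m, hm, -⟩
    exact hsound _ _ _ hm
  · intro hs
    have hex : ∃ m, ∃ r, event X c m = some r ∧ (r.1 <+: p ∨ p <+: r.1) := by
      obtain ⟨m, hm⟩ := hcomplete _ _ hs
      exact ⟨m, _, hm, Or.inl (List.prefix_refl p)⟩
    classical
    obtain ⟨⟨q, s'⟩, hr, hcomp⟩ := Nat.find_spec hex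
    have hs' := hsound _ _ _ hr
    have hq : q = p := by
      rcases hcomp with h | h
      · exact hfree _ (Part.dom_iff_mem.2 ⟨_, hs'⟩) _ (Part.dom_iff_mem.2 ⟨_, hs⟩) h
      · exact (hfree _ (Part.dom_iff_mem.2 ⟨_, hs⟩) _ (Part.dom_iff_mem.2 ⟨_, hs'⟩) h).symm
    subst hq
    obtain rfl := Part.mem_unique hs hs'
    exact ⟨_, hr, fun k hk r hkr hc => Nat.find_min hex hk ⟨r, hkr, hc⟩⟩

/-- The machine is a universal prefix-free machine, for every oracle. -/
theorem universal_isUniversal (X : BinSeq) : IsUniversalPrefixFree X (universal X) := by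
  refine ⟨⟨universal_recursiveIn X, universal_prefixFree X⟩, fun M hM => ?_⟩
  obtain ⟨c, hc⟩ := exists_prefixFreeRun X hM
  refine ⟨List.replicate (Encodable.encode c) false ++ [true], fun p => ?_⟩
  rw [List.append_assoc, List.singleton_append, universal_header, Denumerable.ofNat_encode, hc]

/-- With the zero oracle, the machine is an ordinary partial recursive function. -/
theorem universal_partrec : Partrec (universal fun _ => false) :=
  RecursiveIn.partrec_of_const (s := Part.some 0) (universal_recursiveIn fun _ => false)

/-- Every string is an output of the machine, so that its complexity is an attained minimum. -/
theorem relK_spec (X : BinSeq) (s : Str) :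
    ∃ w : Str, w.length = relK X s ∧ s ∈ universal X w := by
  have hM : IsPrefixFreeMachine X fun p => ((if p = [] then some s else none : Option Str)) := by
    constructor
    · refine Partrec.recursiveIn (Computable.ofOption (Primrec.to_comp ?_))
      exact Primrec.ite (PrimrecRel.comp Primrec.eq Primrec.id (Primrec.const []))
        (Primrec.const _) (Primrec.const _)
    · intro p hp q hq _
      have key : ∀ p : Str, p ∈ PFun.Dom (fun p : Str =>
          (((if p = [] then some s else none : Option Str)) : Part Str)) → p = [] := by
        intro p hp
        obtain ⟨t, ht⟩ := Part.dom_iff_mem.1 hp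
        by_contra hne
        simp [hne] at ht
      rw [key p hp, key q hq]
  obtain ⟨h, hh⟩ := (universal_isUniversal X).2 _ hM
  exact Nat.sInf_mem (s := {k | ∃ w : Str, w.length = k ∧ s ∈ universal X w})
    ⟨_, h ++ [], rfl, by rw [hh]; simp⟩

end AlgInfo

namespace AlgInfo

open MeasureTheory Set
open scoped ENNReal

/-! A short description of an initial segment of `A ⊎ B` would have to save bits either on `B` or on
`A` given `B`. To make this precise, let each halting pair `(p, s)` of the universal machine put the
constant density `2 ^ (|odds s| - |p|)` on the dyadic interval of `odds s`. Its integral is `2 ^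
(-|p|)`, so by the Kraft inequality the total density has integral at most `1`
(`lintegral_density_le_one`).

The density is finite along an incompressible `B` (`Incompressible.density_ne_top`). By Markov's
inequality the set where it reaches `4 ^ (k + 1)` has measure at most `4 ^ (-(k + 1))`. The strings
at which partial sums first witness such a crossing form a decidable antichain, and asking for
descriptions of them that save `k + 1` bits costs at most `2 ^ (-(k + 1))` in weight
(`tsum_weight_crossingRequest_le`). By Kraft-Chaitin (`relK_le_of_requests`), infinite density along
`B` would compress initial segments of `B` by arbitrarily many bits.

Finite density along `B` says that, over the pairs whose odd bits agree with `B`, the sum of `2 ^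
(-(|p| - |odds s|))` converges. Kraft-Chaitin relative to `B` then describes `evens s` with `|p| -
|odds s| + O(1)` bits (`relK_evens_le`). For `s` an initial segment of `A ⊎ B` and `p` a shortest
description of it, the incompressibility of `A` relative to `B` bounds `|p|` from below. -/

/-! ### Dyadic cells -/

/-- The left end point of the dyadic interval of the reals whose binary expansion extends `p`. -/
noncomputable def cellLeft : Str → ℝ
  | [] => 0
  | b :: p => ((if b then 1 else 0) + cellLeft p) / 2

/-- The dyadic interval of the reals whose binary expansion extends `p`. -/
noncomputable def cell (p : Str) : Set ℝ :=
  Ico (cellLeft p) (cellLeft p + 2⁻¹ ^ p.length)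

/-- The numerator of `cellLeft p` over the denominator `2 ^ p.length`. -/
def cellIndex : Str → ℕ
  | [] => 0
  | b :: p => (if b then 2 ^ p.length else 0) + cellIndex p

/-- Integer numerators let the machines below compare end points by primitive recursive integer
arithmetic. -/
theorem cellLeft_eq (p : Str) : cellLeft p = cellIndex p / 2 ^ p.length := by
  induction p with
  | nil => simp [cellLeft, cellIndex]
  | cons b p ih =>
    have : (2 : ℝ) ^ p.length ≠ 0 := by positivity
    cases b <;> simp [cellLeft, cellIndex, ih, pow_succ] <;> field_simp

/-- The doubling map strips the first binary digit; the inductions on cells below rest on it. -/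
theorem mem_cell_cons {b : Bool} {p : Str} {x : ℝ} :
    x ∈ cell (b :: p) ↔ 2 * x - (if b then 1 else 0) ∈ cell p := by
  simp only [cell, cellLeft, mem_Ico, List.length_cons, pow_succ]
  constructor <;> rintro ⟨h1, h2⟩ <;> constructor <;> linarith

theorem cell_subset_unit (p : Str) : cell p ⊆ Ico 0 1 := by
  intro x hx
  induction p generalizing x with
  | nil => simpa [cell, cellLeft] using hx
  | cons b p ih =>
    have := ih (mem_cell_cons.1 hx)
    cases b <;> simp at this ⊢ <;> constructor <;> linarith

theorem cell_anti {p q : Str} (h : p <+: q) : cell q ⊆ cell p := by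
  intro x hx
  induction p generalizing q x with
  | nil =>
    have := cell_subset_unit _ hx
    simpa [cell, cellLeft] using this
  | cons b p ih =>
    obtain ⟨r, rfl⟩ := h
    rw [List.cons_append, mem_cell_cons] at hx
    exact mem_cell_cons.2 (ih (List.prefix_append p r) hx)

/-- A common point determines the bits of both strings one after the other: different first bits
would place it in different halves of the unit interval. -/
theorem prefix_or_prefix_of_mem_cell {p q : Str} {x : ℝ} (hp : x ∈ cell p) (hq : x ∈ cell q) :
    p <+: q ∨ q <+: p := by
  induction p generalizing q x with
  | nil => simp
  | cons b p ih =>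
    cases q with
    | nil => simp
    | cons d q =>
      rw [mem_cell_cons] at hp hq
      have h1 := cell_subset_unit _ hp
      have h2 := cell_subset_unit _ hq
      obtain rfl : b = d := by
        cases b <;> cases d <;> simp at h1 h2 ⊢ <;> linarith
      simpa using ih hp hq

theorem exists_mem_cell (n : ℕ) {x : ℝ} (hx : x ∈ Ico (0 : ℝ) 1) :
    ∃ p : Str, p.length = n ∧ x ∈ cell p := by
  induction n generalizing x with
  | zero => exact ⟨[], rfl, by simpa [cell, cellLeft] using hx⟩
  | succ n ih =>
    rcases lt_or_ge x (1 / 2) with h | h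
    · obtain ⟨p, hp, h'⟩ := ih (x := 2 * x) ⟨by linarith [hx.1], by linarith⟩
      exact ⟨false :: p, by simp [hp], mem_cell_cons.2 (by simpa using h')⟩
    · obtain ⟨p, hp, h'⟩ := ih (x := 2 * x - 1) ⟨by linarith, by linarith [hx.2]⟩
      exact ⟨true :: p, by simp [hp], mem_cell_cons.2 (by simpa using h')⟩

theorem volume_cell (p : Str) : volume (cell p) = 2⁻¹ ^ p.length := by
  rw [cell, Real.volume_Ico, add_sub_cancel_left, ENNReal.ofReal_pow (by norm_num),
    ENNReal.ofReal_inv_of_pos (by norm_num)]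
  norm_num

theorem measurableSet_cell (p : Str) : MeasurableSet (cell p) := measurableSet_Ico

theorem disjoint_cell {p q : Str} (h1 : ¬ p <+: q) (h2 : ¬ q <+: p) :
    Disjoint (cell p) (cell q) :=
  Set.disjoint_left.2 fun _ hp hq => (prefix_or_prefix_of_mem_cell hp hq).elim h1 h2

/-! ### Primitive recursive functions -/

theorem primrec_pow : Primrec₂ ((· ^ ·) : ℕ → ℕ → ℕ) :=
  Primrec₂.unpaired'.1 Nat.Primrec.pow

theorem primrec_sum_range {α : Type*} [Primcodable α] {f : α → ℕ → ℕ} {n : α → ℕ}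
    (hf : Primrec₂ f) (hn : Primrec n) :
    Primrec fun a => ∑ j ∈ Finset.range (n a), f a j := by
  have := Primrec.nat_rec' (h := fun a z => z.2 + f a z.1) hn (Primrec.const 0)
    (Primrec.nat_add.comp (Primrec.snd.comp Primrec.snd)
      (hf.comp Primrec.fst (Primrec.fst.comp Primrec.snd)))
  refine this.of_eq fun a => ?_
  induction n a with
  | zero => rfl
  | succ k ih => rw [Finset.sum_range_succ, ← ih]

theorem primrec_cellIndex : Primrec cellIndex := by
  have := Primrec.list_rec (f := fun p : Str => p) (g := fun _ => 0)
    (h := fun _ z => (if z.1 then 2 ^ z.2.1.length else 0) + z.2.2) Primrec.id (Primrec.const 0)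
    (Primrec.nat_add.comp (Primrec.ite
      (PrimrecRel.comp Primrec.eq (Primrec.fst.comp Primrec.snd) (Primrec.const true))
      (primrec_pow.comp (Primrec.const 2) (Primrec.list_length.comp
        (Primrec.fst.comp (Primrec.snd.comp Primrec.snd)))) (Primrec.const 0))
      (Primrec.snd.comp (Primrec.snd.comp Primrec.snd)))
  refine this.of_eq fun p => ?_
  induction p with
  | nil => rfl
  | cons b p ih => simp [cellIndex, ← ih]

/-! ### Splitting a string into its even and odd bits -/

/-- The bits of `s` at the even positions. -/
def evens (s : Str) : Str := (List.range ((s.length + 1) / 2)).map fun i => s.getD (2 * i) false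

/-- The bits of `s` at the odd positions. -/
def odds (s : Str) : Str := (List.range (s.length / 2)).map fun i => s.getD (2 * i + 1) false

theorem primrec_evens : Primrec evens := by
  refine Primrec.list_map (Primrec.list_range.comp (Primrec.nat_div.comp
    (Primrec.succ.comp Primrec.list_length) (Primrec.const 2))) ?_
  exact (Primrec.list_getD false).comp Primrec.fst
    (Primrec.nat_mul.comp (Primrec.const 2) Primrec.snd)

theorem primrec_odds : Primrec odds := by
  refine Primrec.list_map (Primrec.list_range.comp (Primrec.nat_div.comp
    Primrec.list_length (Primrec.const 2))) ?_
  exact (Primrec.list_getD false).comp Primrec.fst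
    (Primrec.succ.comp (Primrec.nat_mul.comp (Primrec.const 2) Primrec.snd))

theorem odds_length (s : Str) : (odds s).length = s.length / 2 := by simp [odds]

theorem evens_interleave (A B : BinSeq) (n : ℕ) :
    evens (restrict (interleave A B) n) = restrict A ((n + 1) / 2) := by
  rw [evens, restrict_length, restrict]
  refine List.map_congr_left fun i hi => ?_
  have : 2 * i < n := by have := List.mem_range.1 hi; omega
  simp [interleave, this]

theorem odds_interleave (A B : BinSeq) (n : ℕ) :
    odds (restrict (interleave A B) n) = restrict B (n / 2) := by
  rw [odds, restrict_length, restrict]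
  refine List.map_congr_left fun i hi => ?_
  have : 2 * i + 1 < n := by have := List.mem_range.1 hi; omega
  have h2 : (2 * i + 1) / 2 = i := by omega
  simp [interleave, this, h2]

/-! ### Enumerating the graph of a partial recursive function -/

/-- `e` is a primitive recursive enumeration without repetitions of the graph of `U`. -/
structure IsEnumeration (U : Str →. Str) (e : ℕ → Option (Str × Str)) : Prop where
  primrec : Primrec e
  sound : ∀ m p s, e m = some (p, s) → s ∈ U p ∧ p.length ≤ m ∧ s.length ≤ m
  complete : ∀ p s, s ∈ U p → ∃ m, e m = some (p, s)
  injective : ∀ m n p s t, e m = some (p, s) → e n = some (p, t) → m = n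

/-- Stage `m` inspects the triple (input, output, running time) coded by `m`. A code dominates the
lengths of the strings inside it, which gives the length bounds. -/
theorem exists_isEnumeration {U : Str →. Str} (hU : Partrec U) : ∃ e, IsEnumeration U e := by
  obtain ⟨c, hc⟩ := Nat.Partrec.Code.exists_code.1 hU
  have hc' : ∀ p v, v ∈ Nat.Partrec.Code.eval c (Encodable.encode p) ↔
      ∃ s ∈ U p, Encodable.encode s = v := by
    intro p v
    rw [hc]
    simp only [Encodable.encodek, Part.coe_some, Part.bind_some, Part.mem_map_iff]
  -- The second clause makes the running time the least one, so each input has only one such triple.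
  let halts (r : Str × Str × ℕ) : Prop :=
    Nat.Partrec.Code.evaln r.2.2 c (Encodable.encode r.1) = some (Encodable.encode r.2.1) ∧
      Nat.Partrec.Code.evaln (r.2.2 - 1) c (Encodable.encode r.1) = none
  have hdec : DecidablePred halts := fun r => inferInstanceAs (Decidable (_ ∧ _))
  -- Requiring `m` to be the code of what it decodes to ensures that one triple occurs at one stage
  -- only.
  let e (m : ℕ) : Option (Str × Str) := (Encodable.decode (α := Str × Str × ℕ) m).bind fun r =>
    if halts r ∧ Encodable.encode r = m then some (r.1, r.2.1) else none
  have he : ∀ m p s, e m = some (p, s) ↔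
      ∃ t, halts (p, s, t) ∧ Encodable.encode (p, s, t) = m := by
    intro m p s
    constructor
    · intro h
      obtain ⟨⟨p', s', t⟩, -, h⟩ := Option.bind_eq_some_iff.1 h
      split_ifs at h with h1
      simp only [Option.some.injEq, Prod.mk.injEq] at h
      obtain ⟨rfl, rfl⟩ := h
      exact ⟨t, h1⟩
    · rintro ⟨t, h, rfl⟩
      simp only [e, Encodable.encodek, Option.bind_some, h, true_and, if_true]
  refine ⟨e, ?_, ?_, ?_, ?_⟩
  · refine Primrec.option_bind Primrec.decode ?_
    have h1 : Primrec fun z : ℕ × Str × Str × ℕ => z.2.1 := Primrec.fst.comp Primrec.snd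
    have h2 : Primrec fun z : ℕ × Str × Str × ℕ => z.2.2.1 :=
      Primrec.fst.comp (Primrec.snd.comp Primrec.snd)
    have h3 : Primrec fun z : ℕ × Str × Str × ℕ => z.2.2.2 :=
      Primrec.snd.comp (Primrec.snd.comp Primrec.snd)
    refine Primrec.ite (PrimrecPred.and (PrimrecPred.and
      (PrimrecRel.comp Primrec.eq (Nat.Partrec.Code.primrec_evaln.comp (.pair (.pair h3
        (Primrec.const c)) (Primrec.encode.comp h1)))
        (Primrec.option_some.comp (Primrec.encode.comp h2)))
      (PrimrecRel.comp Primrec.eq (Nat.Partrec.Code.primrec_evaln.comp (.pair (.pair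
        (Primrec.nat_sub.comp h3 (Primrec.const 1)) (Primrec.const c)) (Primrec.encode.comp h1)))
        (Primrec.const none)))
      (PrimrecRel.comp Primrec.eq (Primrec.encode.comp Primrec.snd) Primrec.fst))
      (Primrec.option_some.comp (.pair h1 h2)) (Primrec.const none)
  · intro m p s h
    obtain ⟨t, ht, rfl⟩ := (he _ _ _).1 h
    refine ⟨?_, ?_, ?_⟩
    · obtain ⟨s', hs', h'⟩ := (hc' _ _).1 (Nat.Partrec.Code.evaln_sound ht.1)
      obtain rfl : s' = s := Encodable.encode_injective h'
      exact hs'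
    · exact (Encodable.length_le_encode p).trans (Nat.left_le_pair _ _)
    · exact (Encodable.length_le_encode s).trans
        ((Nat.left_le_pair _ _).trans (Nat.right_le_pair _ _))
  · intro p s hs
    have hex := Nat.Partrec.Code.evaln_complete.1 ((hc' _ _).2 ⟨s, hs, rfl⟩)
    classical
    refine ⟨_, (he _ _ _).2 ⟨Nat.find hex, ⟨Nat.find_spec hex, ?_⟩, rfl⟩⟩
    -- Nothing halts with step bound `0`, so the truncated predecessor of the running time is a true
    -- predecessor.
    have hpos : 0 < Nat.find hex := by
      rw [Nat.find_pos]
      simp [Nat.Partrec.Code.evaln]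
    by_contra hne
    obtain ⟨v, hv⟩ := Option.ne_none_iff_exists'.1 hne
    have h1 := Nat.Partrec.Code.evaln_mono (Nat.sub_le (Nat.find hex) 1) hv
    have h2 := Nat.find_spec hex
    obtain rfl : v = _ := Option.some_injective _ (h1.symm.trans h2)
    exact Nat.find_min hex (Nat.sub_lt hpos one_pos) hv
  · intro m n p s t hm hn
    obtain ⟨i, h1, rfl⟩ := (he _ _ _).1 hm
    obtain ⟨j, h2, rfl⟩ := (he _ _ _).1 hn
    have key : ∀ {i j s t}, halts (p, s, i) → halts (p, t, j) → j ≤ i := by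
      intro i j s t h1 h2
      by_contra hlt
      have := Nat.Partrec.Code.evaln_mono (show i ≤ j - 1 by omega) h1.1
      have h3 := h2.2
      simp only [Option.mem_def] at this h3
      simp [this] at h3
    obtain rfl : i = j := le_antisymm (key h2 h1) (key h1 h2)
    obtain rfl : s = t := Encodable.encode_injective (Option.some_injective _ (h1.1.symm.trans h2.1))
    rfl

/-! ### The Kraft-Chaitin theorem relative to an oracle -/

/-- An unbounded search whose stages depend primitive recursively on initial segments of the oracle
is partial recursive in the oracle. -/
theorem search_strings_recursiveIn (X : BinSeq) {F : Str → Str → ℕ → Option Str}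
    (hF : Primrec fun z : Str × Str × ℕ => F z.1 z.2.1 z.2.2) :
    RecursiveIn {oracleOf X} fun p => Nat.rfindOpt fun m => F p (restrict X m) m := by
  have h1 := search_recursiveIn X
    (fun a x m => (Encodable.decode (α := Str) a).bind fun w =>
      (F w x m).map Encodable.encode) ?_
  · refine h1.of_eq fun n => ?_
    cases hn : Encodable.decode (α := Str) n with
    | none =>
      ext v
      simp [mem_rfindOpt_iff]
    | some w =>
      ext v
      simp only [Option.bind_some, Part.coe_some, Part.bind_some, Part.mem_map_iff,
        mem_rfindOpt_iff, Option.map_eq_some_iff, Option.map_eq_none_iff]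
      constructor
      · rintro ⟨m, ⟨s, hs, rfl⟩, h⟩
        exact ⟨s, ⟨m, hs, h⟩, rfl⟩
      · rintro ⟨s, ⟨m, hs, h⟩, rfl⟩
        exact ⟨m, ⟨s, hs, rfl⟩, h⟩
  · apply Primrec.to_comp
    refine Primrec.option_bind (Primrec.decode.comp Primrec.fst) ?_
    refine Primrec.option_map (hF.comp (.pair Primrec.snd (Primrec.snd.comp Primrec.fst))) ?_
    exact (Primrec.encode.comp Primrec.snd).to₂

/-- The weight of a request for a description of length `r.1` of the string `r.2`. -/
noncomputable def weight (r : Option (ℕ × Str)) : ℝ := r.elim 0 fun r => 2⁻¹ ^ r.1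

/-- The weight of a request, over the denominator `2 ^ D`. -/
def scaledWeight (D : ℕ) (r : Option (ℕ × Str)) : ℕ := r.elim 0 fun r => 2 ^ (D - r.1)

theorem weight_nonneg (r : Option (ℕ × Str)) : 0 ≤ weight r := by
  cases r <;> simp [weight]

theorem scaledWeight_eq {D : ℕ} {r : Option (ℕ × Str)} (h : ∀ q ∈ r, q.1 ≤ D) :
    (scaledWeight D r : ℝ) = weight r * 2 ^ D := by
  cases r with
  | none => simp [scaledWeight, weight]
  | some q =>
    obtain ⟨k, hk⟩ := Nat.exists_eq_add_of_le (h q rfl)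
    simp only [scaledWeight, weight, Option.elim_some, hk, Nat.add_sub_cancel_left]
    push_cast
    rw [pow_add, ← mul_assoc, ← mul_pow]
    norm_num

theorem primrec_scaledWeight : Primrec₂ scaledWeight := by
  have : Primrec₂ fun (D : ℕ) (r : Option (ℕ × Str)) =>
      Option.casesOn (motive := fun _ => ℕ) r 0 fun q => 2 ^ (D - q.1) :=
    Primrec.option_casesOn Primrec.snd (Primrec.const 0)
      (primrec_pow.comp (Primrec.const 2) (Primrec.nat_sub.comp (Primrec.fst.comp Primrec.fst)
        (Primrec.fst.comp Primrec.snd)))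
  exact this.of_eq fun D r => by cases r <;> rfl

/-- The oracle machine for a list of requests: the input `p` is a description for the request
number `m` if its length is larger by one than the one requested, and its cell lies between the
sums of the weights of the first `m` and the first `m + 1` requests. -/
def serve (req : Str → ℕ → Option (ℕ × Str)) (D : ℕ) (p x : Str) (m : ℕ) : Option Str :=
  (req x m).bind fun r =>
    if r.1 + 1 = p.length ∧
      (∑ j ∈ Finset.range m, scaledWeight (m + D) (req (x.take j) j)) * 2 ^ p.length ≤
        cellIndex p * 2 ^ (m + D) ∧
      (cellIndex p + 1) * 2 ^ (m + D) ≤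
        ((∑ j ∈ Finset.range m, scaledWeight (m + D) (req (x.take j) j)) +
          scaledWeight (m + D) (some r)) * 2 ^ p.length
    then some r.2 else none

theorem primrec_serve {req : Str → ℕ → Option (ℕ × Str)} (hreq : Primrec₂ req) (D : ℕ) :
    Primrec fun z : Str × Str × ℕ => serve req D z.1 z.2.1 z.2.2 := by
  unfold serve
  refine Primrec.option_bind (hreq.comp (Primrec.fst.comp Primrec.snd)
    (Primrec.snd.comp Primrec.snd)) ?_
  have hp : Primrec fun z : (Str × Str × ℕ) × ℕ × Str => z.1.1 := Primrec.fst.comp Primrec.fst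
  have hm : Primrec fun z : (Str × Str × ℕ) × ℕ × Str => z.1.2.2 + D :=
    Primrec.nat_add.comp (Primrec.snd.comp (Primrec.snd.comp Primrec.fst)) (Primrec.const D)
  have hr : Primrec fun z : (Str × Str × ℕ) × ℕ × Str => z.2.1 := Primrec.fst.comp Primrec.snd
  have hl : Primrec fun z : (Str × Str × ℕ) × ℕ × Str => 2 ^ z.1.1.length :=
    primrec_pow.comp (Primrec.const 2) (Primrec.list_length.comp hp)
  have hd : Primrec fun z : (Str × Str × ℕ) × ℕ × Str => 2 ^ (z.1.2.2 + D) :=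
    primrec_pow.comp (Primrec.const 2) hm
  have hs : Primrec fun z : (Str × Str × ℕ) × ℕ × Str =>
      ∑ j ∈ Finset.range z.1.2.2, scaledWeight (z.1.2.2 + D) (req (z.1.2.1.take j) j) := by
    refine primrec_sum_range ?_ (Primrec.snd.comp (Primrec.snd.comp Primrec.fst))
    exact primrec_scaledWeight.comp (hm.comp Primrec.fst) (hreq.comp (Primrec.list_take.comp
      Primrec.snd (Primrec.fst.comp (Primrec.snd.comp (Primrec.fst.comp Primrec.fst))))
      Primrec.snd)
  refine Primrec.ite (PrimrecPred.and ?_ (PrimrecPred.and ?_ ?_))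
    (Primrec.option_some.comp (Primrec.snd.comp Primrec.snd)) (Primrec.const none)
  · exact PrimrecRel.comp Primrec.eq (Primrec.succ.comp hr) (Primrec.list_length.comp hp)
  · exact PrimrecRel.comp Primrec.nat_le (Primrec.nat_mul.comp hs hl)
      (Primrec.nat_mul.comp (primrec_cellIndex.comp hp) hd)
  · exact PrimrecRel.comp Primrec.nat_le
      (Primrec.nat_mul.comp (Primrec.succ.comp (primrec_cellIndex.comp hp)) hd)
      (Primrec.nat_mul.comp (Primrec.nat_add.comp hs (primrec_scaledWeight.comp hm
        (Primrec.option_some.comp Primrec.snd))) hl)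

/-- The sum of the weights of the first `m` requests. -/
noncomputable def weightSum (req : Str → ℕ → Option (ℕ × Str)) (X : BinSeq) (m : ℕ) : ℝ :=
  ∑ j ∈ Finset.range m, weight (req (restrict X j) j)

theorem weightSum_mono (req : Str → ℕ → Option (ℕ × Str)) (X : BinSeq) :
    Monotone (weightSum req X) :=
  monotone_nat_of_le_succ fun m => by
    rw [weightSum, weightSum, Finset.sum_range_succ]
    exact le_add_of_nonneg_right (weight_nonneg _)

/-- The integer test in `serve` is the real one after clearing the denominators `2 ^ p.length` and
`2 ^ (m + D)`. By `hD`, every length requested up to stage `m` is at most `m + D`, so no subtraction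
in `scaledWeight` is truncated. -/
theorem serve_eq_some_iff {req : Str → ℕ → Option (ℕ × Str)} {X : BinSeq} {D : ℕ}
    (hD : ∀ j, ∀ r ∈ req (restrict X j) j, r.1 ≤ j + D) {p s : Str} {m : ℕ} :
    serve req D p (restrict X m) m = some s ↔ ∃ l, req (restrict X m) m = some (l, s) ∧
      l + 1 = p.length ∧ weightSum req X m ≤ cellLeft p ∧
        cellLeft p + 2⁻¹ ^ p.length ≤ weightSum req X (m + 1) := by
  have hsum : ((∑ j ∈ Finset.range m,
      scaledWeight (m + D) (req ((restrict X m).take j) j) : ℕ) : ℝ) =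
      weightSum req X m * 2 ^ (m + D) := by
    rw [weightSum, Finset.sum_mul, Nat.cast_sum]
    refine Finset.sum_congr rfl fun j hj => ?_
    have hj := Finset.mem_range.1 hj
    rw [restrict_take X hj.le, scaledWeight_eq fun q hq => (hD j q hq).trans (by omega)]
  have key : ∀ r, req (restrict X m) m = some r →
      (((∑ j ∈ Finset.range m, scaledWeight (m + D) (req ((restrict X m).take j) j)) *
        2 ^ p.length ≤ cellIndex p * 2 ^ (m + D) ∧ (cellIndex p + 1) * 2 ^ (m + D) ≤
        ((∑ j ∈ Finset.range m, scaledWeight (m + D) (req ((restrict X m).take j) j)) +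
          scaledWeight (m + D) (some r)) * 2 ^ p.length) ↔
      weightSum req X m ≤ cellLeft p ∧
        cellLeft p + 2⁻¹ ^ p.length ≤ weightSum req X (m + 1)) := by
    intro r hr
    have h1 : (0 : ℝ) < 2 ^ p.length := by positivity
    have h2 : (0 : ℝ) < 2 ^ (m + D) := by positivity
    have hw : (scaledWeight (m + D) (some r) : ℝ) = weight (some r) * 2 ^ (m + D) :=
      scaledWeight_eq fun q hq => hD m q (by rw [hr]; exact hq)
    have hnext : weightSum req X (m + 1) = weightSum req X m + weight (some r) := by
      rw [weightSum, Finset.sum_range_succ, hr]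
      rfl
    rw [← Nat.cast_le (α := ℝ), ← Nat.cast_le (α := ℝ)]
    push_cast [hsum, hw]
    rw [hnext, cellLeft_eq, inv_pow]
    refine and_congr ?_ ?_
    · rw [le_div_iff₀ h1, mul_right_comm, mul_le_mul_iff_left₀ h2]
    · rw [← one_div, ← add_div, div_le_iff₀ h1, ← add_mul, mul_right_comm _ (2 ^ (m + D) : ℝ),
        mul_le_mul_iff_left₀ h2]
  unfold serve
  rw [Option.bind_eq_some_iff]
  constructor
  · rintro ⟨⟨l, t⟩, hr, h⟩
    split_ifs at h with h1
    obtain rfl : t = s := by simpa using h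
    exact ⟨l, hr, h1.1, (key _ hr).1 h1.2⟩
  · rintro ⟨l, hr, h1, h2⟩
    refine ⟨(l, s), hr, ?_⟩
    rw [if_pos ⟨h1, (key _ hr).2 h2⟩]

theorem relK_le {X : BinSeq} {w s : Str} (h : s ∈ universal X w) : relK X s ≤ w.length :=
  Nat.sInf_le ⟨w, rfl, h⟩

/-- The Kraft-Chaitin theorem: a list of requests of total weight at most `1`, primitive recursive
in the oracle, is satisfied up to an additive constant. -/
theorem relK_le_of_requests {req : Str → ℕ → Option (ℕ × Str)} (hreq : Primrec₂ req) (X : BinSeq)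
    {D : ℕ} (hD : ∀ j, ∀ r ∈ req (restrict X j) j, r.1 ≤ j + D)
    (hsum : ∀ m, weightSum req X m ≤ 1) :
    ∃ C, ∀ j l s, req (restrict X j) j = some (l, s) → relK X s ≤ l + C := by
  -- Different stages own intervals that do not overlap, while `p <+: q` puts the left end point of
  -- the cell of `q` into both cells. So both inputs serve one stage, which fixes their length.
  have hfree : ∀ {p q s t : Str} {m n : ℕ}, p <+: q →
      serve req D p (restrict X m) m = some s → serve req D q (restrict X n) n = some t →
      m = n ∧ p.length = q.length := by
    intro p q s t m n hpq hp hq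
    obtain ⟨l, hl, hlp, h1, h2⟩ := (serve_eq_some_iff hD).1 hp
    obtain ⟨k, hk, hkq, h3, h4⟩ := (serve_eq_some_iff hD).1 hq
    have hx : cellLeft q ∈ cell q := ⟨le_rfl, lt_add_of_pos_right _ (by positivity)⟩
    have hx' := cell_anti hpq hx
    have h5 := hx.2
    rcases lt_trichotomy m n with hlt | rfl | hlt
    · have := weightSum_mono req X (show m + 1 ≤ n from hlt)
      linarith [hx'.2]
    · rw [hl] at hk
      simp only [Option.some.injEq, Prod.mk.injEq] at hk
      exact ⟨rfl, by omega⟩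
    · have := weightSum_mono req X (show n + 1 ≤ m from hlt)
      linarith [hx'.1]
  have hM : IsPrefixFreeMachine X fun p => Nat.rfindOpt fun m => serve req D p (restrict X m) m := by
    refine ⟨search_strings_recursiveIn X (primrec_serve hreq D), fun p hp q hq hpq => ?_⟩
    obtain ⟨s, hs⟩ := Part.dom_iff_mem.1 hp
    obtain ⟨t, ht⟩ := Part.dom_iff_mem.1 hq
    obtain ⟨m, hm, -⟩ := mem_rfindOpt_iff.1 hs
    obtain ⟨n, hn, -⟩ := mem_rfindOpt_iff.1 ht
    exact hpq.eq_of_length (hfree hpq hm hn).2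
  obtain ⟨h, hh⟩ := (universal_isUniversal X).2 _ hM
  -- The constant pays for the header and for the extra bit that `serve` demands.
  refine ⟨h.length + 1, fun j l s hj => ?_⟩
  have hnext : weightSum req X (j + 1) = weightSum req X j + 2⁻¹ ^ l := by
    rw [weightSum, Finset.sum_range_succ, hj]
    rfl
  have hnonneg : 0 ≤ weightSum req X j := Finset.sum_nonneg fun _ _ => weight_nonneg _
  have hpos : (0 : ℝ) < 2⁻¹ ^ (l + 1) := by positivity
  have hhalf : (2⁻¹ : ℝ) ^ l = 2⁻¹ ^ (l + 1) + 2⁻¹ ^ (l + 1) := by rw [pow_succ]; ring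
  -- The interval of request `j` has length `2 ^ (-l)`. The cell of half that length around its
  -- midpoint fits inside, even if the interval is not aligned to the dyadic grid.
  obtain ⟨p, hp, hx⟩ := exists_mem_cell (l + 1) (x := weightSum req X j + 2⁻¹ ^ (l + 1))
    ⟨by linarith, by linarith [hsum (j + 1)]⟩
  have hserve : serve req D p (restrict X j) j = some s := by
    refine (serve_eq_some_iff hD).2 ⟨l, hj, hp.symm, ?_, ?_⟩
    · have := hx.2
      rw [hp] at this
      linarith
    · rw [hp]
      linarith [hx.1]
  have hmem : s ∈ universal X (h ++ p) := by
    rw [hh]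
    refine mem_rfindOpt_iff.2 ⟨j, hserve, fun k hk => ?_⟩
    by_contra hne
    obtain ⟨t, ht⟩ := Option.ne_none_iff_exists'.1 hne
    exact hk.ne (hfree (List.prefix_refl p) ht hserve).1
  refine (relK_le hmem).trans ?_
  rw [List.length_append, hp]
  omega

/-! ### The density of the outputs above their odd bits -/

open scoped Classical in
/-- If the enumerated pair number `j` is `(p, s)` and the string `odds s` satisfies `P`, then
`2 ^ ((odds s).length - p.length)`, and `0` otherwise. -/
noncomputable def load (e : ℕ → Option (Str × Str)) (P : Str → Prop) (j : ℕ) : ℝ≥0∞ :=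
  (e j).elim 0 fun r => if P (odds r.2) then 2 ^ (odds r.2).length * 2⁻¹ ^ r.1.length else 0

theorem load_of_eq {e : ℕ → Option (Str × Str)} {j : ℕ} {p s : Str} (h : e j = some (p, s))
    {P : Str → Prop} (hP : P (odds s)) :
    load e P j = 2 ^ (odds s).length * 2⁻¹ ^ p.length := by
  simp [load, h, hP]

theorem load_mono (e : ℕ → Option (Str × Str)) {P Q : Str → Prop} (j : ℕ)
    (h : ∀ p s, e j = some (p, s) → P (odds s) → Q (odds s)) : load e P j ≤ load e Q j := by
  unfold load
  cases hj : e j with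
  | none => simp
  | some r =>
    simp only [Option.elim_some]
    split_ifs with h1 h2
    · exact le_rfl
    · exact absurd (h _ _ hj h1) h2
    · exact zero_le
    · exact le_rfl

/-- The sum of all loads. -/
noncomputable def density (e : ℕ → Option (Str × Str)) (P : Str → Prop) : ℝ≥0∞ :=
  ∑' j, load e P j

theorem two_pow_mul_inv_pow (n : ℕ) : (2 : ℝ≥0∞) ^ n * 2⁻¹ ^ n = 1 := by
  rw [← mul_pow, ENNReal.mul_inv_cancel two_ne_zero ENNReal.ofNat_ne_top, one_pow]

theorem measurable_load (e : ℕ → Option (Str × Str)) (j : ℕ) :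
    Measurable fun x : ℝ => load e (fun q => x ∈ cell q) j := by
  unfold load
  cases e j with
  | none => exact measurable_const
  | some r => exact Measurable.ite (measurableSet_cell _) measurable_const measurable_const

/-- The load of `(p, s)` lives on a cell of measure `2 ^ (-|odds s|)`, so its integral is the
measure of `cell p`. These cells are disjoint subsets of the unit interval, since the domain is
prefix-free and no input is enumerated twice. -/
theorem lintegral_density_le_one {U : Str →. Str} {e : ℕ → Option (Str × Str)}
    (he : IsEnumeration U e) (hU : PrefixFree U.Dom) :
    ∫⁻ x : ℝ, density e (fun q => x ∈ cell q) ≤ 1 := by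
  classical
  unfold density
  rw [lintegral_tsum fun j => (measurable_load e j).aemeasurable]
  let I (j : ℕ) : Set ℝ := (e j).elim ∅ fun r => cell r.1
  have hI : ∀ j, ∫⁻ x : ℝ, load e (fun q => x ∈ cell q) j = volume (I j) := by
    intro j
    simp only [I, load]
    cases e j with
    | none => simp
    | some r =>
      simp only [Option.elim_some]
      have : (fun x => if x ∈ cell (odds r.2) then
          (2 : ℝ≥0∞) ^ (odds r.2).length * 2⁻¹ ^ r.1.length else 0) =
          (cell (odds r.2)).indicator fun _ => (2 : ℝ≥0∞) ^ (odds r.2).length * 2⁻¹ ^ r.1.length := by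
        funext x
        simp [Set.indicator]
      rw [this, lintegral_indicator_const (measurableSet_cell _), volume_cell, volume_cell,
        mul_right_comm, two_pow_mul_inv_pow, one_mul]
  have hm : ∀ j, MeasurableSet (I j) := by
    intro j
    simp only [I]
    cases e j with
    | none => exact MeasurableSet.empty
    | some r => exact measurableSet_cell _
  have hdisj : Pairwise (Function.onFun Disjoint I) := by
    intro i j hij
    simp only [Function.onFun, I]
    cases hi : e i with
    | none => simp
    | some r =>
      cases hj : e j with
      | none => simp
      | some q =>
        have hr := Part.dom_iff_mem.2 ⟨_, (he.sound _ _ _ hi).1⟩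
        have hq := Part.dom_iff_mem.2 ⟨_, (he.sound _ _ _ hj).1⟩
        have hne : r.1 ≠ q.1 := fun h => hij (he.injective i j r.1 r.2 q.2 hi (by rw [hj, h]))
        exact disjoint_cell (fun h => hne (hU _ hr _ hq h)) fun h => hne (hU _ hq _ hr h).symm
  simp only [hI]
  rw [← measure_iUnion hdisj hm]
  refine (measure_mono (t := Ico 0 1) (iUnion_subset fun j => ?_)).trans (by simp)
  simp only [I]
  cases e j with
  | none => simp
  | some r => exact cell_subset_unit _

/-! ### Strings at which the density becomes large -/

/-- The string `y` is a minimal witness that the density exceeds `4 ^ (k + 1)`. -/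
def Crosses (e : ℕ → Option (Str × Str)) (k : ℕ) (y : Str) : Prop :=
  4 ^ (k + 1) < ∑ j ∈ Finset.range y.length, load e (· <+: y) j ∧
    ∑ j ∈ Finset.range (y.length - 1), load e (· <+: y) j ≤ 4 ^ (k + 1)

/-- If `y` were a proper prefix of `z`, the load that `y` has gathered would already count for `z`
by stage `z.length - 1`, against the minimality of `z`. -/
theorem Crosses.eq_of_prefix {e : ℕ → Option (Str × Str)} {k : ℕ} {y z : Str}
    (hy : Crosses e k y) (hz : Crosses e k z) (h : y <+: z) : y = z := by
  by_contra hne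
  have hlt : y.length < z.length :=
    lt_of_le_of_ne h.length_le fun hl => hne (h.eq_of_length hl)
  refine absurd (hy.1.trans_le ?_) hz.2.not_gt
  calc ∑ j ∈ Finset.range y.length, load e (· <+: y) j
      ≤ ∑ j ∈ Finset.range y.length, load e (· <+: z) j :=
        Finset.sum_le_sum fun j _ => load_mono e j fun _ _ _ h' => h'.trans h
    _ ≤ ∑ j ∈ Finset.range (z.length - 1), load e (· <+: z) j :=
        Finset.sum_le_sum_of_subset (Finset.range_mono (by omega))

open scoped Classical in
-- Markov's inequality for the density: the crossing strings form an antichain, so their cells are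
-- disjoint, and they lie where the density is at least `4 ^ (k + 1)`.
theorem tsum_crosses_le {U : Str →. Str} {e : ℕ → Option (Str × Str)}
    (he : IsEnumeration U e) (hU : PrefixFree U.Dom) (k : ℕ) :
    ∑' y : Str, (if Crosses e k y then (2⁻¹ : ℝ≥0∞) ^ y.length else 0) ≤
      2⁻¹ ^ (2 * (k + 1)) := by
  let I (y : Str) : Set ℝ := if Crosses e k y then cell y else ∅
  have hI : ∀ y, (if Crosses e k y then (2⁻¹ : ℝ≥0∞) ^ y.length else 0) = volume (I y) := by
    intro y
    simp only [I]
    split_ifs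
    · rw [volume_cell]
    · simp
  have hm : ∀ y, MeasurableSet (I y) := by
    intro y
    simp only [I]
    split_ifs
    · exact measurableSet_cell _
    · exact MeasurableSet.empty
  have hdisj : Pairwise (Function.onFun Disjoint I) := by
    intro y z hne
    simp only [Function.onFun, I]
    split_ifs with hy hz
    · exact disjoint_cell (fun h => hne (hy.eq_of_prefix hz h))
        fun h => hne (hz.eq_of_prefix hy h).symm
    all_goals simp
  simp only [hI]
  rw [← measure_iUnion hdisj hm]
  have hsub : ⋃ y, I y ⊆ {x | 4 ^ (k + 1) ≤ density e fun q => x ∈ cell q} := by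
    refine iUnion_subset fun y x hx => ?_
    simp only [I] at hx
    split_ifs at hx with hy
    · refine hy.1.le.trans ?_
      calc ∑ j ∈ Finset.range y.length, load e (· <+: y) j
          ≤ ∑ j ∈ Finset.range y.length, load e (fun q => x ∈ cell q) j :=
            Finset.sum_le_sum fun j _ => load_mono e j fun _ _ _ h => cell_anti h hx
        _ ≤ density e fun q => x ∈ cell q := ENNReal.sum_le_tsum _
    · exact absurd hx (notMem_empty x)
  refine (measure_mono hsub).trans ?_
  have hmarkov := (mul_meas_ge_le_lintegral (μ := volume)
    (Measurable.tsum (measurable_load e)) (4 ^ (k + 1))).trans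
      (lintegral_density_le_one he hU)
  have h4 : (4 : ℝ≥0∞) ^ (k + 1) = 2 ^ (2 * (k + 1)) := by rw [pow_mul]; norm_num
  rw [h4] at hmarkov ⊢
  calc _ = 2⁻¹ ^ (2 * (k + 1)) * (2 ^ (2 * (k + 1)) * volume _) := by
        rw [← mul_assoc, mul_comm (2⁻¹ ^ _), two_pow_mul_inv_pow, one_mul]
    _ ≤ 2⁻¹ ^ (2 * (k + 1)) * 1 := by gcongr; exact hmarkov
    _ = _ := mul_one _

/-- A single term of the preceding sum already obeys its bound. Consequently the length asked for in
`crossingRequest` is not a truncated difference. -/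
theorem Crosses.le_length {U : Str →. Str} {e : ℕ → Option (Str × Str)}
    (he : IsEnumeration U e) (hU : PrefixFree U.Dom) {k : ℕ} {y : Str} (h : Crosses e k y) :
    k + 1 ≤ y.length := by
  classical
  have h1 := (ENNReal.le_tsum y).trans (tsum_crosses_le he hU k)
  rw [if_pos h, ← ENNReal.inv_pow, ← ENNReal.inv_pow, ENNReal.inv_le_inv] at h1
  have h2 : 2 ^ (2 * (k + 1)) ≤ 2 ^ y.length := by exact_mod_cast h1
  have := (Nat.pow_le_pow_iff_right (by norm_num)).1 h2
  omega

/-- The load of the prefixes of `y`, over the denominator `2 ^ N`. -/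
def scaledLoad (e : ℕ → Option (Str × Str)) (y : Str) (N j : ℕ) : ℕ :=
  (e j).elim 0 fun r =>
    if odds r.2 <+: y then 2 ^ (N + (odds r.2).length - r.1.length) else 0

/-- A pair enumerated at stage `j ≤ N` has `p.length ≤ N`, so the exponent in `scaledLoad` is not
truncated. -/
theorem scaledLoad_eq {U : Str →. Str} {e : ℕ → Option (Str × Str)}
    (he : IsEnumeration U e) (y : Str) {N j : ℕ} (h : j ≤ N) :
    (scaledLoad e y N j : ℝ≥0∞) = load e (· <+: y) j * 2 ^ N := by
  unfold scaledLoad load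
  cases hj : e j with
  | none => simp
  | some r =>
    simp only [Option.elim_some]
    split_ifs
    · obtain ⟨i, hi⟩ := Nat.exists_eq_add_of_le ((he.sound _ _ _ hj).2.1.trans h)
      have h1 : N + (odds r.2).length - r.1.length = i + (odds r.2).length := by omega
      rw [h1, hi]
      push_cast
      rw [pow_add, pow_add, mul_assoc, ← mul_assoc (2⁻¹ ^ _), mul_comm (2⁻¹ ^ _),
        two_pow_mul_inv_pow, one_mul, mul_comm]
    · simp

theorem primrec_scaledLoad {e : ℕ → Option (Str × Str)} (he : Primrec e) :
    Primrec fun z : (Str × ℕ) × ℕ => scaledLoad e z.1.1 z.1.2 z.2 := by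
  have : Primrec fun z : (Str × ℕ) × ℕ => Option.casesOn (motive := fun _ => ℕ) (e z.2) 0 fun r =>
      if odds r.2 <+: z.1.1 then 2 ^ (z.1.2 + (odds r.2).length - r.1.length) else 0 := by
    refine Primrec.option_casesOn (he.comp Primrec.snd) (Primrec.const 0) ?_
    have ho : Primrec fun w : ((Str × ℕ) × ℕ) × Str × Str => odds w.2.2 :=
      primrec_odds.comp (Primrec.snd.comp Primrec.snd)
    exact Primrec.ite (isPrefix_primrec.comp ho
      (Primrec.fst.comp (Primrec.fst.comp Primrec.fst)))
      (primrec_pow.comp (Primrec.const 2) (Primrec.nat_sub.comp (Primrec.nat_add.comp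
        (Primrec.snd.comp (Primrec.fst.comp Primrec.fst)) (Primrec.list_length.comp ho))
        (Primrec.list_length.comp (Primrec.fst.comp Primrec.snd)))) (Primrec.const 0)
  exact this.of_eq fun z => by unfold scaledLoad; cases e z.2 <;> rfl

/-- Only the first `y.length` pairs enter, and all their loads have denominator dividing `2 ^
y.length`; crossing is thus a comparison of integers, hence primitive recursive. -/
theorem crosses_iff {U : Str →. Str} {e : ℕ → Option (Str × Str)}
    (he : IsEnumeration U e) (k : ℕ) (y : Str) :
    Crosses e k y ↔
      4 ^ (k + 1) * 2 ^ y.length < ∑ j ∈ Finset.range y.length, scaledLoad e y y.length j ∧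
      ∑ j ∈ Finset.range (y.length - 1), scaledLoad e y y.length j ≤
        4 ^ (k + 1) * 2 ^ y.length := by
  have hsum : ∀ n ≤ y.length,
      ((∑ j ∈ Finset.range n, scaledLoad e y y.length j : ℕ) : ℝ≥0∞) =
        (∑ j ∈ Finset.range n, load e (· <+: y) j) * 2 ^ y.length := by
    intro n hn
    rw [Finset.sum_mul, Nat.cast_sum]
    exact Finset.sum_congr rfl fun j hj =>
      scaledLoad_eq he y ((Finset.mem_range.1 hj).le.trans hn)
  have h0 : (2 : ℝ≥0∞) ^ y.length ≠ 0 := pow_ne_zero _ two_ne_zero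
  have htop : (2 : ℝ≥0∞) ^ y.length ≠ ∞ := ENNReal.pow_ne_top ENNReal.ofNat_ne_top
  unfold Crosses
  rw [← Nat.cast_lt (α := ℝ≥0∞), ← Nat.cast_le (α := ℝ≥0∞), hsum _ le_rfl, hsum _ (Nat.sub_le _ _)]
  push_cast
  rw [ENNReal.mul_lt_mul_iff_left h0 htop, ENNReal.mul_le_mul_iff_left h0 htop]

theorem crosses_primrec {U : Str →. Str} {e : ℕ → Option (Str × Str)} (he : IsEnumeration U e) :
    PrimrecPred fun z : Str × ℕ => Crosses e z.2 z.1 := by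
  have hl : Primrec fun z : Str × ℕ => z.1.length := Primrec.list_length.comp Primrec.fst
  have hb : Primrec fun z : Str × ℕ => 4 ^ (z.2 + 1) * 2 ^ z.1.length :=
    Primrec.nat_mul.comp (primrec_pow.comp (Primrec.const 4) (Primrec.succ.comp Primrec.snd))
      (primrec_pow.comp (Primrec.const 2) hl)
  have hs : Primrec₂ fun (z : Str × ℕ) (j : ℕ) => scaledLoad e z.1 z.1.length j :=
    (primrec_scaledLoad he.primrec).comp (.pair (.pair (Primrec.fst.comp Primrec.fst)
      (hl.comp Primrec.fst)) Primrec.snd)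
  refine PrimrecPred.of_eq (PrimrecPred.and
    (PrimrecRel.comp Primrec.nat_lt hb (primrec_sum_range hs hl))
    (PrimrecRel.comp Primrec.nat_le
      (primrec_sum_range hs (Primrec.nat_sub.comp hl (Primrec.const 1))) hb))
    fun z => (crosses_iff he _ _).symm

open scoped Classical in
/-- The request number `(y, k)` asks for a description of `y` that saves `k + 1` bits, provided
that `y` is a minimal witness for a density above `4 ^ (k + 1)`. -/
noncomputable def crossingRequest (e : ℕ → Option (Str × Str)) (m : ℕ) : Option (ℕ × Str) :=
  (Encodable.decode (α := Str × ℕ) m).bind fun r =>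
    if Crosses e r.2 r.1 ∧ Encodable.encode r = m then some (r.1.length - (r.2 + 1), r.1) else none

theorem crossingRequest_eq_some_iff {e : ℕ → Option (Str × Str)} {m : ℕ} {q : ℕ × Str} :
    crossingRequest e m = some q ↔ ∃ k, Crosses e k q.2 ∧ Encodable.encode (q.2, k) = m ∧
      q.1 = q.2.length - (k + 1) := by
  constructor
  · intro h
    obtain ⟨⟨y, k⟩, -, h⟩ := Option.bind_eq_some_iff.1 h
    split_ifs at h with h1
    obtain rfl := Option.some_injective _ h
    exact ⟨k, h1.1, h1.2, rfl⟩
  · rintro ⟨k, h, rfl, h'⟩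
    simp only [crossingRequest, Encodable.encodek, Option.bind_some, h, true_and, if_true, ← h']

theorem primrec_crossingRequest {U : Str →. Str} {e : ℕ → Option (Str × Str)}
    (he : IsEnumeration U e) : Primrec (crossingRequest e) := by
  classical
  refine Primrec.option_bind Primrec.decode ?_
  have hr : Primrec fun z : ℕ × Str × ℕ => z.2 := Primrec.snd
  refine Primrec.ite (PrimrecPred.and ((crosses_primrec he).comp hr)
    (PrimrecRel.comp Primrec.eq (Primrec.encode.comp hr) Primrec.fst))
    (Primrec.option_some.comp (.pair (Primrec.nat_sub.comp
      (Primrec.list_length.comp (Primrec.fst.comp hr)) (Primrec.succ.comp (Primrec.snd.comp hr)))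
      (Primrec.fst.comp hr))) (Primrec.const none)

theorem weightSum_le_one {req : Str → ℕ → Option (ℕ × Str)} {X : BinSeq}
    (h : ∑' j, ENNReal.ofReal (weight (req (restrict X j) j)) ≤ 1) (m : ℕ) :
    weightSum req X m ≤ 1 := by
  rw [← ENNReal.ofReal_le_one, weightSum, ENNReal.ofReal_sum_of_nonneg fun _ _ => weight_nonneg _]
  exact (ENNReal.sum_le_tsum _).trans h

theorem ofReal_weight_some (r : ℕ × Str) : ENNReal.ofReal (weight (some r)) = 2⁻¹ ^ r.1 := by
  rw [weight, Option.elim_some, ENNReal.ofReal_pow (by norm_num),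
    ENNReal.ofReal_inv_of_pos (by norm_num)]
  norm_num

theorem two_inv_pow_sub {a b : ℕ} (h : b ≤ a) :
    (2⁻¹ : ℝ≥0∞) ^ (a - b) = 2 ^ b * 2⁻¹ ^ a := by
  obtain ⟨i, rfl⟩ := Nat.exists_eq_add_of_le h
  rw [Nat.add_sub_cancel_left, pow_add, ← mul_assoc, two_pow_mul_inv_pow, one_mul]

/-- At level `k` the crossing strings weigh at most `4 ^ (-(k + 1))`, and saving `k + 1` bits
multiplies this by `2 ^ (k + 1)`. The remaining `2 ^ (-(k + 1))` sum to `1`; thresholds growing like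
`2 ^ k` would leave no convergent series. -/
theorem tsum_weight_crossingRequest_le {U : Str →. Str} {e : ℕ → Option (Str × Str)}
    (he : IsEnumeration U e) (hU : PrefixFree U.Dom) :
    ∑' m, ENNReal.ofReal (weight (crossingRequest e m)) ≤ 1 := by
  classical
  have hsupp : Function.support (fun m => ENNReal.ofReal (weight (crossingRequest e m))) ⊆
      Set.range (Encodable.encode : Str × ℕ → ℕ) := by
    intro m hm
    cases h : crossingRequest e m with
    | none => simp [h, weight] at hm
    | some q =>
      obtain ⟨k, -, hk, -⟩ := crossingRequest_eq_some_iff.1 h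
      exact ⟨_, hk⟩
  have hterm : ∀ z : Str × ℕ, ENNReal.ofReal (weight (crossingRequest e (Encodable.encode z))) =
      2 ^ (z.2 + 1) * (if Crosses e z.2 z.1 then 2⁻¹ ^ z.1.length else 0) := by
    rintro ⟨y, k⟩
    dsimp only
    split_ifs with h
    · have hreq : crossingRequest e (Encodable.encode (y, k)) = some (y.length - (k + 1), y) :=
        crossingRequest_eq_some_iff.2 ⟨k, h, rfl, rfl⟩
      rw [hreq, ofReal_weight_some, two_inv_pow_sub (h.le_length he hU)]
    · have hreq : crossingRequest e (Encodable.encode (y, k)) = none := by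
        by_contra hne
        obtain ⟨q, hq⟩ := Option.ne_none_iff_exists'.1 hne
        obtain ⟨i, hi, h', -⟩ := crossingRequest_eq_some_iff.1 hq
        obtain ⟨rfl, rfl⟩ := Prod.mk.inj (Encodable.encode_injective h')
        exact h hi
      rw [hreq, mul_zero]
      simp [weight]
  rw [← Function.Injective.tsum_eq Encodable.encode_injective hsupp]
  simp only [hterm]
  rw [ENNReal.tsum_prod', ENNReal.tsum_comm]
  calc ∑' k : ℕ, ∑' y : Str,
        (2 : ℝ≥0∞) ^ (k + 1) * (if Crosses e k y then 2⁻¹ ^ y.length else 0)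
      ≤ ∑' k : ℕ, (2⁻¹ : ℝ≥0∞) ^ (k + 1) := by
        refine ENNReal.tsum_le_tsum fun k => ?_
        rw [ENNReal.tsum_mul_left]
        refine (mul_le_mul_right (tsum_crosses_le he hU k) _).trans_eq ?_
        rw [two_mul, pow_add (2⁻¹ : ℝ≥0∞), ← mul_assoc, two_pow_mul_inv_pow, one_mul]
    _ = 1 := by
        rw [ENNReal.tsum_geometric_add_one, ENNReal.one_sub_inv_two, inv_inv]
        exact ENNReal.inv_mul_cancel two_ne_zero ENNReal.ofNat_ne_top

theorem prefix_restrict_iff {q : Str} {X : BinSeq} {n : ℕ} (h : q.length ≤ n) :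
    q <+: restrict X n ↔ q = restrict X q.length := by
  rw [List.prefix_iff_eq_take, restrict_take X h]

/-- The density is finite along an incompressible sequence. -/
theorem Incompressible.density_ne_top {B : BinSeq} (hB : Incompressible B) {U : Str →. Str}
    {e : ℕ → Option (Str × Str)} (he : IsEnumeration U e) (hU : PrefixFree U.Dom) :
    density e (fun q => q = restrict B q.length) ≠ ∞ := by
  intro htop
  obtain ⟨C, hC⟩ := relK_le_of_requests (req := fun _ m => crossingRequest e m)
    ((primrec_crossingRequest he).comp Primrec.snd) (fun _ => false) (D := 0) (by
      intro j r hr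
      obtain ⟨k, -, rfl, h⟩ := crossingRequest_eq_some_iff.1 hr
      have h1 := (Encodable.length_le_encode r.2).trans (Nat.left_le_pair _ (Encodable.encode k))
      rw [Encodable.encode_prod_val]
      omega) (weightSum_le_one (tsum_weight_crossingRequest_le he hU))
  obtain ⟨c, hc⟩ := hB
  -- Level `k = C + c` saves `C + c + 1` bits: after paying the constant `C`, this still beats the
  -- deficiency `c` allowed to `B`.
  have hex : ∃ N, 4 ^ (C + c + 1) <
      ∑ j ∈ Finset.range N, load e (fun q => q = restrict B q.length) j := by
    by_contra! hle
    have := ENNReal.tsum_le_of_sum_range_le hle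
    rw [← density, htop, top_le_iff] at this
    exact ENNReal.pow_ne_top ENNReal.ofNat_ne_top this
  classical
  have hspec := Nat.find_spec hex
  have hmin : ∀ n < Nat.find hex, _ := fun n hn => not_lt.1 (Nat.find_min hex hn)
  generalize Nat.find hex = N at hspec hmin
  have hN : N ≠ 0 := by
    rintro rfl
    simp at hspec
  -- A pair enumerated before stage `N` has odd bits shorter than `N`, so agreeing with `B` and
  -- being a prefix of `restrict B N` are the same.
  have hsum : ∀ n ≤ N, ∑ j ∈ Finset.range n, load e (· <+: restrict B N) j =
      ∑ j ∈ Finset.range n, load e (fun q => q = restrict B q.length) j := by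
    intro n hn
    refine Finset.sum_congr rfl fun j hj => ?_
    have hiff : ∀ p s, e j = some (p, s) →
        (odds s <+: restrict B N ↔ odds s = restrict B (odds s).length) := by
      intro p s h
      refine prefix_restrict_iff ?_
      have := (he.sound _ _ _ h).2.2
      have := Finset.mem_range.1 hj
      rw [odds_length]
      omega
    exact le_antisymm (load_mono e j fun p s h => (hiff p s h).1)
      (load_mono e j fun p s h => (hiff p s h).2)
  have hcross : Crosses e (C + c) (restrict B N) := by
    unfold Crosses
    rw [restrict_length, hsum _ le_rfl, hsum _ (Nat.sub_le _ _)]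
    exact ⟨hspec, hmin _ (by omega)⟩
  have hlen := hcross.le_length he hU
  have h1 := hC _ _ _ (crossingRequest_eq_some_iff
    (q := ((restrict B N).length - (C + c + 1), restrict B N)).2 ⟨_, hcross, rfl, rfl⟩)
  have h2 := hc N
  rw [restrict_length] at h1 hlen
  unfold prefixK at h2
  omega

/-! ### Descriptions of the even bits relative to the odd bits -/

/-- If the enumerated pair number `j` is `(p, s)` and `odds s` is an initial segment of the
oracle, this asks for a description of `evens s` of length `p.length + d - (odds s).length`. -/
def evensRequest (e : ℕ → Option (Str × Str)) (d : ℕ) (x : Str) (j : ℕ) : Option (ℕ × Str) :=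
  (e j).bind fun r => if odds r.2 <+: x ∧ (odds r.2).length ≤ r.1.length + d then
    some (r.1.length + d - (odds r.2).length, evens r.2) else none

theorem primrec_evensRequest {e : ℕ → Option (Str × Str)} (he : Primrec e) (d : ℕ) :
    Primrec₂ (evensRequest e d) := by
  refine Primrec.option_bind (he.comp Primrec.snd) ?_
  have ho : Primrec fun z : (Str × ℕ) × Str × Str => odds z.2.2 :=
    primrec_odds.comp (Primrec.snd.comp Primrec.snd)
  have hl : Primrec fun z : (Str × ℕ) × Str × Str => z.2.1.length + d :=
    Primrec.nat_add.comp (Primrec.list_length.comp (Primrec.fst.comp Primrec.snd))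
      (Primrec.const d)
  exact Primrec.ite (PrimrecPred.and (isPrefix_primrec.comp ho (Primrec.fst.comp Primrec.fst))
    (PrimrecRel.comp Primrec.nat_le (Primrec.list_length.comp ho) hl))
    (Primrec.option_some.comp (.pair (Primrec.nat_sub.comp hl (Primrec.list_length.comp ho))
      (primrec_evens.comp (Primrec.snd.comp Primrec.snd)))) (Primrec.const none)

/-- Equality holds whenever the request is made. Otherwise the left side is `0`, possibly because
`restrict X n` is still too short. -/
theorem ofReal_weight_evensRequest_le (e : ℕ → Option (Str × Str)) (d : ℕ) (X : BinSeq) (j n : ℕ) :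
    ENNReal.ofReal (weight (evensRequest e d (restrict X n) j)) ≤
      2⁻¹ ^ d * load e (fun q => q = restrict X q.length) j := by
  cases hj : e j with
  | none => simp [evensRequest, hj, weight]
  | some r =>
    by_cases h : odds r.2 <+: restrict X n ∧ (odds r.2).length ≤ r.1.length + d
    · have hreq : evensRequest e d (restrict X n) j =
          some (r.1.length + d - (odds r.2).length, evens r.2) := by
        simp [evensRequest, hj, h]
      have hle : (odds r.2).length ≤ n := by simpa [restrict_length] using h.1.length_le
      rw [hreq, ofReal_weight_some, two_inv_pow_sub h.2, load_of_eq hj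
        ((prefix_restrict_iff hle).1 h.1), pow_add]
      exact le_of_eq (by ring)
    · have hreq : evensRequest e d (restrict X n) j = none := by
        simp only [evensRequest, hj, Option.bind_some, if_neg h]
      simp [hreq, weight]

/-- If the density along `X` is finite, then a description of `s` whose odd bits agree with `X`
yields, relative to `X`, a description of the even bits that is shorter by `(odds s).length`. -/
theorem relK_evens_le {U : Str →. Str} {e : ℕ → Option (Str × Str)} (he : IsEnumeration U e)
    {X : BinSeq} (hX : density e (fun q => q = restrict X q.length) ≠ ∞) :
    ∃ C, ∀ p s, s ∈ U p → odds s = restrict X (odds s).length →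
      relK X (evens s) + (odds s).length ≤ p.length + C := by
  -- Lengthening every request by `d` bits brings the total weight down to at most `1`.
  obtain ⟨d, hd⟩ : ∃ d : ℕ, density e (fun q => q = restrict X q.length) ≤ 2 ^ d := by
    obtain ⟨d, hd⟩ := ENNReal.exists_nat_gt hX
    refine ⟨d, hd.le.trans ?_⟩
    exact_mod_cast Nat.lt_two_pow_self.le
  have hsum : ∑' j, ENNReal.ofReal (weight (evensRequest e d (restrict X j) j)) ≤ 1 := by
    refine (ENNReal.tsum_le_tsum fun j => ofReal_weight_evensRequest_le e d X j j).trans ?_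
    rw [ENNReal.tsum_mul_left, ← two_pow_mul_inv_pow d, mul_comm]
    gcongr
    exact hd
  obtain ⟨C, hC⟩ := relK_le_of_requests (primrec_evensRequest he.primrec d) X (D := d) (by
    intro j r hr
    obtain ⟨q, hq, hr⟩ := Option.bind_eq_some_iff.1 hr
    split_ifs at hr
    obtain rfl := Option.some_injective _ hr
    have := (he.sound _ _ _ hq).2.1
    dsimp only
    omega) (weightSum_le_one hsum)
  refine ⟨d + C, fun p s hs hX' => ?_⟩
  obtain ⟨j, hj⟩ := he.complete p s hs
  -- One load alone is at most `2 ^ d`; hence the length requested is not negative and the pair is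
  -- not skipped.
  have hle : (odds s).length ≤ p.length + d := by
    have h1 := (ENNReal.le_tsum j).trans hd
    rw [load_of_eq hj hX'] at h1
    have h2 : (2 : ℝ≥0∞) ^ (odds s).length ≤ 2 ^ (p.length + d) := by
      calc (2 : ℝ≥0∞) ^ (odds s).length
          = 2 ^ p.length * (2 ^ (odds s).length * 2⁻¹ ^ p.length) := by
            rw [mul_left_comm, two_pow_mul_inv_pow, mul_one]
        _ ≤ 2 ^ p.length * 2 ^ d := by gcongr
        _ = _ := (pow_add _ _ _).symm
    have h3 : 2 ^ (odds s).length ≤ 2 ^ (p.length + d) := by exact_mod_cast h2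
    exact (Nat.pow_le_pow_iff_right (by norm_num)).1 h3
  -- Stage `j` sees only `j` bits of the oracle; these suffice because `s.length ≤ j`.
  have hprefix : odds s <+: restrict X j := by
    refine (prefix_restrict_iff ?_).2 hX'
    have := (he.sound _ _ _ hj).2.2
    rw [odds_length]
    omega
  have := hC j (p.length + d - (odds s).length) (evens s) (by simp [evensRequest, hj, hprefix, hle])
  omega

end AlgInfo

open AlgInfo in
theorem mainTheorem9 (A B : AlgInfo.BinSeq)
    (hB : AlgInfo.Incompressible B) (hA : AlgInfo.IncompressibleRel B A) :
    AlgInfo.Incompressible (AlgInfo.interleave A B) := by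
  obtain ⟨e, he⟩ := exists_isEnumeration universal_partrec
  obtain ⟨C, hC⟩ := relK_evens_le he
    (hB.density_ne_top he (universal_prefixFree fun _ => false))
  obtain ⟨c, hc⟩ := hA
  refine ⟨c + C, fun n => ?_⟩
  obtain ⟨p, hp, hmem⟩ := relK_spec (fun _ => false) (restrict (interleave A B) n)
  have h1 := hC p _ hmem (by rw [odds_interleave, restrict_length])
  -- The even bits number `(n + 1) / 2` and the odd bits `n / 2`; the two add up to `n`, leaving the
  -- loss `c + C`.
  have h2 := hc ((n + 1) / 2)
  rw [evens_interleave, odds_interleave, restrict_length, hp] at h1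
  unfold prefixK
  omega
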